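/- Let $\mathbf k$ be a field of characteristic zero; all vector spaces are finite-dimensional and $\mathbb Z/2$-graded, $\Pi$ denotes parity reversion and $\operatorname{Tr}$ the supertrace (trace on the even part minus trace on the odd part). For a dg vector space $(V,d)$ let $\hat S\,\Pi V^*$ be the completed free graded-commutative algebra on $\Pi V^*$, and let $\operatorname{Der}_{\ge 2}(\hat S\,\Pi V^*)$ be its derivations that send $\Pi V^*$ to series without terms of order $<2$. An $L_\infty$ structure on $V$ is an odd $m\in \operatorname{Der}_{\ge 2}(\hat S\,\Pi V^*)$ with $[d,m]+\tfrac12[m,m]=0$; equivalently it is given by symmetric multilinear maps $\tilde m_n\colon(\Pi V)^{\otimes n}\to\Pi V$, $n\ge2$. The divergence of $\xi=\sum_i f_i\partial_{x_i}$ is $\nabla\xi=\sum_i(-1)^{|f_i||x_i|}\partial_{x_i}f_i$, where $x_1,x_2,\dots$ is a homogeneous basis of $\Pi V^*$. A unimodular lift of $m$ is an even $f\in\hat S\,\Pi V^*$ with $d(f)+\tfrac12\nabla(m)+m(f)=0$; the $L_\infty$ algebra $(V,m)$ is strictly unimodular if $f=0$ is a unimodular lift, that is, if $\nabla(m)=0$.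 A unital graded-commutative dg algebra (cdga) $A$ is unimodular if $\operatorname{Tr}(x\mapsto ax)=0$ for every $a\in A$. Let $A$ be a cdga and let $(V,m)$ be an $L_\infty$ algebra. Then there is exactly one $L_\infty$ structure on the dg vector space $A\otimes V$ whose multilinear maps are $$(a_1\otimes v_1,\dots,a_n\otimes v_n)\mapsto \pm\, a_1\cdots a_n\otimes\tilde m_n(v_1,\dots,v_n)$$ (with the sign of the Koszul rule), and for $A\otimes V$ with this structure: 1. $A\otimes V$ is strictly unimodular if and only if $V$ is strictly unimodular or $A$ is unimodular. 2. $A\otimes V$ admits a unimodular lift if and only if $V$ admits a unimodular lift or $A$ is unimodular. -/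

import Mathlib

open scoped TensorProduct

noncomputable section

namespace SuperLInfty

/-! ### Signs and dg super vector spaces -/

/-- The sign `(-1)^i` for `i ∈ ℤ/2`. -/
def sgn (k : Type*) [Field k] (i : ZMod 2) : k := if i = 0 then 1 else -1

/-- The structure of a differential `ℤ/2`-graded vector space on `V`: a splitting into an even part
`part 0` and an odd part `part 1`, and an odd operator `d` of square zero. -/
structure DGSpace (k V : Type*) [Field k] [AddCommGroup V] [Module k V] where
  part : ZMod 2 → Submodule k V
  isCompl : IsCompl (part 0) (part 1)
  d : V →ₗ[k] V
  d_mem : ∀ i, ∀ v ∈ part i, d v ∈ part (i + 1)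
  d_d : ∀ v, d (d v) = 0

section Space

variable {k V : Type*} [Field k] [AddCommGroup V] [Module k V]

theorem zmod_two_cases (i : ZMod 2) : i = 0 ∨ i = 1 := by
  revert i; decide

theorem DGSpace.isCompl_part (𝒱 : DGSpace k V) (i : ZMod 2) :
    IsCompl (𝒱.part i) (𝒱.part (i + 1)) := by
  rcases zmod_two_cases i with rfl | rfl
  · simpa using 𝒱.isCompl
  · have h : (1 + 1 : ZMod 2) = 0 := by decide
    rw [h]; exact 𝒱.isCompl.symm

/-- The projection of `V` onto its component of parity `i`, along the other component. -/
def DGSpace.projOnto (𝒱 : DGSpace k V) (i : ZMod 2) : V →ₗ[k] 𝒱.part i :=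
  Submodule.projectionOnto (𝒱.part i) (𝒱.part (i + 1)) (𝒱.isCompl_part i)

/-- The component of parity `i` of a vector, as a vector. -/
def DGSpace.proj (𝒱 : DGSpace k V) (i : ZMod 2) : V →ₗ[k] V :=
  (𝒱.part i).subtype ∘ₗ 𝒱.projOnto i

/-- The parity involution `v ↦ (-1)^{|v|} v`. -/
def DGSpace.invol (𝒱 : DGSpace k V) : V →ₗ[k] V := 𝒱.proj 0 - 𝒱.proj 1

/-- The parity reversion `ΠV`: the same vectors and the same differential, with the two parities
exchanged. -/
def DGSpace.shift (𝒱 : DGSpace k V) : DGSpace k V where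
  part i := 𝒱.part (i + 1)
  isCompl := by
    have h : (1 + 1 : ZMod 2) = 0 := by decide
    simpa [h] using 𝒱.isCompl.symm
  d := 𝒱.d
  d_mem i v hv := 𝒱.d_mem (i + 1) v hv
  d_d := 𝒱.d_d

/-- The supertrace of an operator: its trace on the even part minus its trace on the odd part
(this is the trace of an endomorphism of a super vector space). -/
def DGSpace.supertrace (𝒱 : DGSpace k V) (φ : V →ₗ[k] V) : k :=
  LinearMap.trace k V (φ ∘ₗ 𝒱.invol)

theorem DGSpace.proj_self (𝒱 : DGSpace k V) {i : ZMod 2} {v : V} (hv : v ∈ 𝒱.part i) :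
    𝒱.proj i v = v := by
  simp only [DGSpace.proj, DGSpace.projOnto, LinearMap.comp_apply, Submodule.subtype_apply]
  exact congrArg Subtype.val
    (Submodule.projectionOnto_apply_left (𝒱.isCompl_part i) ⟨v, hv⟩)

theorem DGSpace.proj_other (𝒱 : DGSpace k V) {i : ZMod 2} {v : V} (hv : v ∈ 𝒱.part (i + 1)) :
    𝒱.proj i v = 0 := by
  simp only [DGSpace.proj, DGSpace.projOnto, LinearMap.comp_apply, Submodule.subtype_apply]
  rw [Submodule.projectionOnto_apply_of_mem_right (𝒱.isCompl_part i) hv]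
  rfl

theorem DGSpace.invol_of_mem (𝒱 : DGSpace k V) {i : ZMod 2} {v : V} (hv : v ∈ 𝒱.part i) :
    𝒱.invol v = sgn k i • v := by
  have h : (1 + 1 : ZMod 2) = 0 := by decide
  rcases zmod_two_cases i with rfl | rfl
  · have h1 : 𝒱.proj 1 v = 0 := 𝒱.proj_other (by rw [h]; exact hv)
    simp [DGSpace.invol, 𝒱.proj_self hv, h1, sgn]
  · have h1 : 𝒱.proj 0 v = 0 := 𝒱.proj_other (by simpa using hv)
    simp [DGSpace.invol, 𝒱.proj_self hv, h1, sgn]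

theorem DGSpace.proj_mem (𝒱 : DGSpace k V) (i : ZMod 2) (v : V) : 𝒱.proj i v ∈ 𝒱.part i :=
  (𝒱.projOnto i v).2

theorem DGSpace.exists_add (𝒱 : DGSpace k V) (v : V) :
    ∃ a ∈ 𝒱.part 0, ∃ b ∈ 𝒱.part 1, a + b = v := by
  have h : v ∈ 𝒱.part 0 ⊔ 𝒱.part 1 := by rw [𝒱.isCompl.sup_eq_top]; trivial
  exact Submodule.mem_sup.mp h

theorem DGSpace.invol_mem (𝒱 : DGSpace k V) {i : ZMod 2} {v : V} (hv : v ∈ 𝒱.part i) :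
    𝒱.invol v ∈ 𝒱.part i := by
  rw [𝒱.invol_of_mem hv]; exact Submodule.smul_mem _ _ hv

theorem sgn_add (i j : ZMod 2) : sgn k (i + j) = sgn k i * sgn k j := by
  have h : (1 + 1 : ZMod 2) = 0 := by decide
  rcases zmod_two_cases i with rfl | rfl <;> rcases zmod_two_cases j with rfl | rfl <;>
    simp [sgn, h]

theorem sgn_mul_self (i : ZMod 2) : sgn k i * sgn k i = 1 := by
  rcases zmod_two_cases i with rfl | rfl <;> simp [sgn]

end Space

/-! ### Commutative dg algebras and tensor products of dg super vector spaces -/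

/-- The structure of a (unital, supercommutative) dg algebra on a `k`-algebra `A`. -/
structure CDGA (k A : Type*) [Field k] [Ring A] [Algebra k A] extends DGSpace k A where
  one_mem : (1 : A) ∈ part 0
  mul_mem : ∀ i j, ∀ a ∈ part i, ∀ b ∈ part j, a * b ∈ part (i + j)
  mul_comm : ∀ i j, ∀ a ∈ part i, ∀ b ∈ part j, a * b = sgn k (i * j) • (b * a)
  leibniz : ∀ i, ∀ a ∈ part i, ∀ b, d (a * b) = d a * b + sgn k i • (a * d b)

/-- A cdga is unimodular if multiplication by every element has zero (super)trace. -/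
def CDGA.Unimodular {k A : Type*} [Field k] [Ring A] [Algebra k A] (𝒜 : CDGA k A) : Prop :=
  ∀ a : A, 𝒜.supertrace (LinearMap.mulLeft k a) = 0

section Tensor

variable {k U V : Type*} [Field k] [AddCommGroup U] [Module k U] [AddCommGroup V] [Module k V]

/-- The component `⨁_j U_j ⊗ V_{i-j}` of parity `i` of `U ⊗ V`. -/
def tensorPart (𝒰 : DGSpace k U) (𝒱 : DGSpace k V) (i : ZMod 2) : Submodule k (U ⊗[k] V) :=
  ⨆ j : ZMod 2, LinearMap.range (TensorProduct.mapIncl (𝒰.part j) (𝒱.part (i - j)))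

theorem tmul_mem_tensorPart (𝒰 : DGSpace k U) (𝒱 : DGSpace k V) {i j : ZMod 2} {u : U} {v : V}
    (hu : u ∈ 𝒰.part i) (hv : v ∈ 𝒱.part j) : u ⊗ₜ[k] v ∈ tensorPart 𝒰 𝒱 (i + j) := by
  refine Submodule.mem_iSup_of_mem i ?_
  have h : i + j - i = j := by ring
  rw [h]
  exact ⟨(⟨u, hu⟩ : 𝒰.part i) ⊗ₜ (⟨v, hv⟩ : 𝒱.part j), by simp [TensorProduct.mapIncl]⟩

theorem tensorPart_induction (𝒰 : DGSpace k U) (𝒱 : DGSpace k V) {i : ZMod 2}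
    {S : Submodule k (U ⊗[k] V)}
    (h : ∀ a b, a + b = i → ∀ u ∈ 𝒰.part a, ∀ v ∈ 𝒱.part b, u ⊗ₜ[k] v ∈ S) :
    tensorPart 𝒰 𝒱 i ≤ S := by
  refine iSup_le fun j => ?_
  rintro _ ⟨x, rfl⟩
  induction x using TensorProduct.induction_on with
  | zero => simp
  | tmul u v =>
    exact h j (i - j) (by ring) u u.2 v v.2
  | add x y hx hy => rw [map_add]; exact S.add_mem hx hy

theorem tensor_invol (𝒰 : DGSpace k U) (𝒱 : DGSpace k V) (i : ZMod 2) {x : U ⊗[k] V}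
    (hx : x ∈ tensorPart 𝒰 𝒱 i) :
    TensorProduct.map 𝒰.invol 𝒱.invol x = sgn k i • x := by
  have key : tensorPart 𝒰 𝒱 i ≤
      LinearMap.eqLocus (TensorProduct.map 𝒰.invol 𝒱.invol) (sgn k i • LinearMap.id) := by
    refine tensorPart_induction 𝒰 𝒱 ?_
    rintro a b rfl u hu v hv
    simp only [LinearMap.mem_eqLocus, TensorProduct.map_tmul, 𝒰.invol_of_mem hu,
      𝒱.invol_of_mem hv, LinearMap.smul_apply, LinearMap.id_apply, sgn_add,
      TensorProduct.smul_tmul_smul]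
  exact key hx

theorem tensorPart_isCompl [CharZero k] (𝒰 : DGSpace k U) (𝒱 : DGSpace k V) :
    IsCompl (tensorPart 𝒰 𝒱 0) (tensorPart 𝒰 𝒱 1) := by
  constructor
  · rw [Submodule.disjoint_def]
    intro x h0 h1
    have e0 := tensor_invol 𝒰 𝒱 0 h0
    have e1 := tensor_invol 𝒰 𝒱 1 h1
    rw [e0] at e1
    simp only [sgn, if_true, one_smul, one_ne_zero, if_false, neg_smul] at e1
    have h2 : (2 : k) • x = 0 := by
      rw [two_smul]; nth_rewrite 1 [e1]; simp
    exact (smul_eq_zero.mp h2).resolve_left two_ne_zero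
  · rw [codisjoint_iff_le_sup]
    intro x _
    have h11 : (1 + 1 : ZMod 2) = 0 := by decide
    induction x using TensorProduct.induction_on with
    | zero => exact Submodule.zero_mem _
    | add x y hx hy => exact Submodule.add_mem _ (hx trivial) (hy trivial)
    | tmul u v =>
      obtain ⟨a, ha, b, hb, rfl⟩ := 𝒰.exists_add u
      obtain ⟨c, hc, e, he, rfl⟩ := 𝒱.exists_add v
      rw [TensorProduct.add_tmul, TensorProduct.tmul_add, TensorProduct.tmul_add]
      have q1 := Submodule.mem_sup_left (T := tensorPart 𝒰 𝒱 1)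
        (tmul_mem_tensorPart 𝒰 𝒱 ha hc)
      have q2 := Submodule.mem_sup_right (S := tensorPart 𝒰 𝒱 0)
        (tmul_mem_tensorPart 𝒰 𝒱 ha he)
      have q3 := Submodule.mem_sup_right (S := tensorPart 𝒰 𝒱 0)
        (tmul_mem_tensorPart 𝒰 𝒱 hb hc)
      have q4 : b ⊗ₜ[k] e ∈ tensorPart 𝒰 𝒱 0 := by
        simpa [h11] using tmul_mem_tensorPart 𝒰 𝒱 hb he
      simp only [add_zero, zero_add] at q1 q2 q3
      exact Submodule.add_mem _ (Submodule.add_mem _ q1 q2)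
        (Submodule.add_mem _ q3 (Submodule.mem_sup_left q4))

/-- The differential `u ⊗ v ↦ du ⊗ v + (-1)^{|u|} u ⊗ dv`. -/
def tensorD (𝒰 : DGSpace k U) (𝒱 : DGSpace k V) : U ⊗[k] V →ₗ[k] U ⊗[k] V :=
  TensorProduct.map 𝒰.d LinearMap.id + TensorProduct.map 𝒰.invol 𝒱.d

theorem tensorD_tmul (𝒰 : DGSpace k U) (𝒱 : DGSpace k V) {i : ZMod 2} {u : U}
    (hu : u ∈ 𝒰.part i) (v : V) :
    tensorD 𝒰 𝒱 (u ⊗ₜ v) = 𝒰.d u ⊗ₜ v + sgn k i • (u ⊗ₜ[k] 𝒱.d v) := by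
  simp [tensorD, 𝒰.invol_of_mem hu, TensorProduct.smul_tmul']

/-- The tensor product of two dg super vector spaces. -/
def DGSpace.tensor [CharZero k] (𝒰 : DGSpace k U) (𝒱 : DGSpace k V) :
    DGSpace k (U ⊗[k] V) where
  part := tensorPart 𝒰 𝒱
  isCompl := tensorPart_isCompl 𝒰 𝒱
  d := tensorD 𝒰 𝒱
  d_mem i x hx := by
    have key : tensorPart 𝒰 𝒱 i ≤ (tensorPart 𝒰 𝒱 (i + 1)).comap (tensorD 𝒰 𝒱) := by
      refine tensorPart_induction 𝒰 𝒱 ?_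
      rintro a b rfl u hu v hv
      rw [Submodule.mem_comap, tensorD_tmul 𝒰 𝒱 hu]
      have h1 := tmul_mem_tensorPart 𝒰 𝒱 (𝒰.d_mem a u hu) hv
      have h2 := tmul_mem_tensorPart 𝒰 𝒱 hu (𝒱.d_mem b v hv)
      rw [show a + 1 + b = a + b + 1 by ring] at h1
      rw [← add_assoc] at h2
      exact Submodule.add_mem _ h1 (Submodule.smul_mem _ _ h2)
    exact key hx
  d_d x := by
    induction x using TensorProduct.induction_on with
    | zero => simp
    | add x y hx hy => rw [map_add, map_add, hx, hy, add_zero]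
    | tmul u v =>
      have key : ∀ i, ∀ a ∈ 𝒰.part i, tensorD 𝒰 𝒱 (tensorD 𝒰 𝒱 (a ⊗ₜ v)) = 0 := by
        intro i a ha
        rw [tensorD_tmul 𝒰 𝒱 ha, map_add, map_smul, tensorD_tmul 𝒰 𝒱 (𝒰.d_mem i a ha),
          tensorD_tmul 𝒰 𝒱 ha, 𝒰.d_d, 𝒱.d_d, sgn_add]
        simp [sgn]
      obtain ⟨a, ha, b, hb, rfl⟩ := 𝒰.exists_add u
      rw [TensorProduct.add_tmul, map_add, map_add, key 0 a ha, key 1 b hb, add_zero]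

end Tensor

/-! ### The complete symmetric algebra of the dual space -/

section Forms

variable {k W : Type*} [Field k] [AddCommGroup W] [Module k W]

/-- The complete symmetric algebra `Ŝ W^*` (formal functions on a finite-dimensional super space
`W`), as `∏_n ((W^{⊗ n})_{S_n})^*`: a formal function is the family of its Taylor coefficients at
the origin, which are multilinear forms on `W` that are symmetric in the super sense. The form of
arity `n` is the restriction of `f` to lists of length `n`. -/
def Form (𝒲 : DGSpace k W) : Submodule k (List W → k) where
  carrier := {f |
    (∀ l₁ l₂ u v, f (l₁ ++ (u + v) :: l₂) = f (l₁ ++ u :: l₂) + f (l₁ ++ v :: l₂)) ∧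
    (∀ l₁ l₂ (c : k) u, f (l₁ ++ (c • u) :: l₂) = c * f (l₁ ++ u :: l₂)) ∧
    (∀ l₁ l₂ i j, ∀ u ∈ 𝒲.part i, ∀ v ∈ 𝒲.part j,
      f (l₁ ++ u :: v :: l₂) = sgn k (i * j) * f (l₁ ++ v :: u :: l₂))}
  zero_mem' := by simp
  add_mem' := by
    rintro f g ⟨f1, f2, f3⟩ ⟨g1, g2, g3⟩
    refine ⟨fun l₁ l₂ u v => ?_, fun l₁ l₂ c u => ?_, fun l₁ l₂ i j u hu v hv => ?_⟩
    · simp only [Pi.add_apply, f1, g1]; ring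
    · simp only [Pi.add_apply, f2, g2]; ring
    · simp only [Pi.add_apply, f3 l₁ l₂ i j u hu v hv, g3 l₁ l₂ i j u hu v hv]; ring
  smul_mem' := by
    rintro c f ⟨f1, f2, f3⟩
    refine ⟨fun l₁ l₂ u v => ?_, fun l₁ l₂ c u => ?_, fun l₁ l₂ i j u hu v hv => ?_⟩
    · simp only [Pi.smul_apply, f1, smul_eq_mul]; ring
    · simp only [Pi.smul_apply, f2, smul_eq_mul]; ring
    · simp only [Pi.smul_apply, f3 l₁ l₂ i j u hu v hv, smul_eq_mul]; ring

/-- `f` is homogeneous of parity `q`: it vanishes on homogeneous arguments of any other total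
parity. -/
def HasParity {𝒲 : DGSpace k W} (q : ZMod 2) (f : Form 𝒲) : Prop :=
  ∀ (l : List W) (s : List (ZMod 2)), List.Forall₂ (fun w i => w ∈ 𝒲.part i) l s →
    s.sum ≠ q → f.1 l = 0

/-- `f ∈ Ŝ_{≥ n} W^*`. -/
def AtLeast {𝒲 : DGSpace k W} (n : ℕ) (f : Form 𝒲) : Prop :=
  ∀ l : List W, l.length < n → f.1 l = 0

/-- Contraction with `w` in the first slot, on families of multilinear forms. -/
def cut (w : W) (f : List W → k) : List W → k := fun l => f (w :: l)

/-- The operator `f ↦ (-1)^{|w| |f|} f`, for `w` of parity `i`. -/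
def twist (𝒲 : DGSpace k W) (i : ZMod 2) (f : List W → k) : List W → k :=
  if i = 0 then f else fun l => f (l.map 𝒲.invol)

theorem cut_mem {𝒲 : DGSpace k W} (w : W) {f : List W → k} (hf : f ∈ Form 𝒲) :
    cut w f ∈ Form 𝒲 := by
  obtain ⟨f1, f2, f3⟩ := hf
  exact ⟨fun l₁ l₂ u v => f1 (w :: l₁) l₂ u v, fun l₁ l₂ c u => f2 (w :: l₁) l₂ c u,
    fun l₁ l₂ i j u hu v hv => f3 (w :: l₁) l₂ i j u hu v hv⟩

theorem twist_mem {𝒲 : DGSpace k W} (i : ZMod 2) {f : List W → k} (hf : f ∈ Form 𝒲) :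
    twist 𝒲 i f ∈ Form 𝒲 := by
  unfold twist
  split_ifs
  · exact hf
  · obtain ⟨f1, f2, f3⟩ := hf
    refine ⟨fun l₁ l₂ u v => ?_, fun l₁ l₂ c u => ?_, fun l₁ l₂ i j u hu v hv => ?_⟩
    · simp only [List.map_append, List.map_cons, map_add, f1]
    · simp only [List.map_append, List.map_cons, map_smul, f2]
    · simp only [List.map_append, List.map_cons]
      exact f3 _ _ i j _ (𝒲.invol_mem hu) _ (𝒲.invol_mem hv)

theorem cut_add {𝒲 : DGSpace k W} {f : List W → k} (hf : f ∈ Form 𝒲) (u v : W) :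
    cut (u + v) f = cut u f + cut v f := by
  funext l; exact hf.1 [] l u v

theorem cut_smul {𝒲 : DGSpace k W} {f : List W → k} (hf : f ∈ Form 𝒲) (c : k) (u : W) :
    cut (c • u) f = c • cut u f := by
  funext l; exact hf.2.1 [] l c u

theorem cut_zero {𝒲 : DGSpace k W} {f : List W → k} (hf : f ∈ Form 𝒲) :
    cut (0 : W) f = 0 := by
  have h := cut_smul hf (0 : k) (0 : W)
  simpa using h

theorem cut_cut {𝒲 : DGSpace k W} {f : List W → k} (hf : f ∈ Form 𝒲) {i j : ZMod 2} {u v : W}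
    (hu : u ∈ 𝒲.part i) (hv : v ∈ 𝒲.part j) :
    cut v (cut u f) = sgn k (i * j) • cut u (cut v f) := by
  funext l; exact hf.2.2 [] l i j u hu v hv

/-- The left partial derivative `∂_w` along a vector `w`: for homogeneous coordinates
`x_1, …, x_n ∈ W^*` and the dual basis `e_1, …, e_n` of `W`, the operator `∂_{x_i}` is
`∂_{e_i}`. -/
def deriv (𝒲 : DGSpace k W) (w : W) : Form 𝒲 →ₗ[k] Form 𝒲 where
  toFun f := ⟨cut w f.1, cut_mem w f.2⟩
  map_add' _ _ := rfl
  map_smul' _ _ := rfl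

/-- The product of two families of multilinear forms, evaluated on a list. It is the (shuffle)
product for which the value at the origin is multiplicative and every `∂_w` is a derivation:
`∂_w (f g) = (∂_w f) g + (-1)^{|w| |f|} f (∂_w g)`. -/
def mulAux (𝒲 : DGSpace k W) : List W → (List W → k) → (List W → k) → k
  | [], f, g => f [] * g []
  | w :: l, f, g => mulAux 𝒲 l (cut w f) g +
      (mulAux 𝒲 l (twist 𝒲 0 f) (cut (𝒲.proj 0 w) g) +
        mulAux 𝒲 l (twist 𝒲 1 f) (cut (𝒲.proj 1 w) g))

set_option linter.unusedSectionVars false in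
theorem cut_add_fun (w : W) (f g : List W → k) : cut w (f + g) = cut w f + cut w g := rfl

set_option linter.unusedSectionVars false in
theorem cut_smul_fun (w : W) (c : k) (f : List W → k) : cut w (c • f) = c • cut w f := rfl

theorem twist_add (𝒲 : DGSpace k W) (i : ZMod 2) (f g : List W → k) :
    twist 𝒲 i (f + g) = twist 𝒲 i f + twist 𝒲 i g := by
  unfold twist; split_ifs <;> rfl

theorem twist_smul (𝒲 : DGSpace k W) (i : ZMod 2) (c : k) (f : List W → k) :
    twist 𝒲 i (c • f) = c • twist 𝒲 i f := by
  unfold twist; split_ifs <;> rfl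

theorem mulAux_add_left (𝒲 : DGSpace k W) (l : List W) (f f' g : List W → k) :
    mulAux 𝒲 l (f + f') g = mulAux 𝒲 l f g + mulAux 𝒲 l f' g := by
  induction l generalizing f f' g with
  | nil => simp [mulAux, add_mul]
  | cons w l ih => simp only [mulAux, cut_add_fun, twist_add, ih]; ring

theorem mulAux_add_right (𝒲 : DGSpace k W) (l : List W) (f g g' : List W → k) :
    mulAux 𝒲 l f (g + g') = mulAux 𝒲 l f g + mulAux 𝒲 l f g' := by
  induction l generalizing f g g' with
  | nil => simp [mulAux, mul_add]
  | cons w l ih => simp only [mulAux, cut_add_fun, ih]; ring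

theorem mulAux_smul_left (𝒲 : DGSpace k W) (l : List W) (c : k) (f g : List W → k) :
    mulAux 𝒲 l (c • f) g = c * mulAux 𝒲 l f g := by
  induction l generalizing f g with
  | nil => simp [mulAux, mul_assoc]
  | cons w l ih => simp only [mulAux, cut_smul_fun, twist_smul, ih]; ring

theorem mulAux_smul_right (𝒲 : DGSpace k W) (l : List W) (c : k) (f g : List W → k) :
    mulAux 𝒲 l f (c • g) = c * mulAux 𝒲 l f g := by
  induction l generalizing f g with
  | nil => simp only [mulAux, Pi.smul_apply, smul_eq_mul]; ring
  | cons w l ih => simp only [mulAux, cut_smul_fun, ih]; ring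

theorem mulAux_zero_right (𝒲 : DGSpace k W) (l : List W) (f : List W → k) :
    mulAux 𝒲 l f 0 = 0 := by
  simpa using mulAux_smul_right 𝒲 l (0 : k) f 0

theorem mulAux_cons_homog (𝒲 : DGSpace k W) {i : ZMod 2} {w : W} (hw : w ∈ 𝒲.part i)
    (l : List W) (f : List W → k) {g : List W → k} (hg : g ∈ Form 𝒲) :
    mulAux 𝒲 (w :: l) f g = mulAux 𝒲 l (cut w f) g + mulAux 𝒲 l (twist 𝒲 i f) (cut w g) := by
  have h11 : (1 + 1 : ZMod 2) = 0 := by decide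
  rcases zmod_two_cases i with rfl | rfl
  · have h1 : 𝒲.proj 1 w = 0 := 𝒲.proj_other (by rw [h11]; exact hw)
    simp [mulAux, 𝒲.proj_self hw, h1, cut_zero hg, mulAux_zero_right]
  · have h1 : 𝒲.proj 0 w = 0 := 𝒲.proj_other (by simpa using hw)
    simp [mulAux, 𝒲.proj_self hw, h1, cut_zero hg, mulAux_zero_right]

theorem cut_twist (𝒲 : DGSpace k W) {i j : ZMod 2} {w : W} (hw : w ∈ 𝒲.part j)
    {f : List W → k} (hf : f ∈ Form 𝒲) :
    cut w (twist 𝒲 i f) = sgn k (i * j) • twist 𝒲 i (cut w f) := by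
  rcases zmod_two_cases i with rfl | rfl
  · simp [twist, sgn]
  · funext l
    have h := congrFun (cut_smul hf (sgn k j) w) (l.map 𝒲.invol)
    simp only [twist, one_ne_zero, if_false, cut, List.map_cons, 𝒲.invol_of_mem hw, one_mul,
      Pi.smul_apply] at h ⊢
    exact h

theorem twist_twist (𝒲 : DGSpace k W) (i j : ZMod 2) (f : List W → k) :
    twist 𝒲 i (twist 𝒲 j f) = twist 𝒲 j (twist 𝒲 i f) := by
  unfold twist; split_ifs <;> rfl

theorem mulAux_mem (𝒲 : DGSpace k W) {f g : List W → k} (hf : f ∈ Form 𝒲) (hg : g ∈ Form 𝒲) :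
    (fun l => mulAux 𝒲 l f g) ∈ Form 𝒲 := by
  refine ⟨fun l₁ => ?_, fun l₁ => ?_, fun l₁ => ?_⟩
  · induction l₁ generalizing f g with
    | nil =>
      intro l₂ u v
      simp only [List.nil_append, mulAux, cut_add hf, map_add, cut_add hg, mulAux_add_left,
        mulAux_add_right]
      ring
    | cons w l ih =>
      intro l₂ u v
      beta_reduce at ih
      simp only [List.cons_append, mulAux]
      rw [ih (cut_mem _ hf) hg, ih (twist_mem 0 hf) (cut_mem _ hg),
        ih (twist_mem 1 hf) (cut_mem _ hg)]
      ring
  · induction l₁ generalizing f g with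
    | nil =>
      intro l₂ c u
      simp only [List.nil_append, mulAux, cut_smul hf, map_smul, cut_smul hg, mulAux_smul_left,
        mulAux_smul_right]
      ring
    | cons w l ih =>
      intro l₂ c u
      beta_reduce at ih
      simp only [List.cons_append, mulAux]
      rw [ih (cut_mem _ hf) hg, ih (twist_mem 0 hf) (cut_mem _ hg),
        ih (twist_mem 1 hf) (cut_mem _ hg)]
      ring
  · induction l₁ generalizing f g with
    | nil =>
      intro l₂ i j u hu v hv
      simp only [List.nil_append]
      rw [mulAux_cons_homog 𝒲 hu _ _ hg, mulAux_cons_homog 𝒲 hv _ _ hg,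
        mulAux_cons_homog 𝒲 hv _ _ (cut_mem _ hg), mulAux_cons_homog 𝒲 hv _ _ hg,
        mulAux_cons_homog 𝒲 hu _ _ hg, mulAux_cons_homog 𝒲 hu _ _ (cut_mem _ hg),
        cut_cut hf hu hv, cut_cut hg hu hv, cut_twist 𝒲 hv hf, cut_twist 𝒲 hu hf,
        twist_twist 𝒲 i j, mul_comm j i]
      simp only [mulAux_smul_left, mulAux_smul_right]
      have h := sgn_mul_self (k := k) (i * j)
      linear_combination (-(mulAux 𝒲 l₂ (twist 𝒲 j (cut u f)) (cut v g))) * h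
    | cons w l ih =>
      intro l₂ i j u hu v hv
      beta_reduce at ih
      simp only [List.cons_append, mulAux]
      rw [ih (cut_mem _ hf) hg l₂ i j u hu v hv, ih (twist_mem 0 hf) (cut_mem _ hg) l₂ i j u hu v hv,
        ih (twist_mem 1 hf) (cut_mem _ hg) l₂ i j u hu v hv]
      ring

/-- The product of the algebra `Ŝ W^*`. -/
def mul {𝒲 : DGSpace k W} (f g : Form 𝒲) : Form 𝒲 :=
  ⟨fun l => mulAux 𝒲 l f.1 g.1, mulAux_mem 𝒲 f.2 g.2⟩

/-- The inclusion `W^* ⊆ Ŝ W^*` of the linear functions. -/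
def lin (𝒲 : DGSpace k W) : Module.Dual k W →ₗ[k] Form 𝒲 where
  toFun x := ⟨fun l => match l with
    | [w] => x w
    | _ => 0, by
    refine ⟨fun l₁ l₂ u v => ?_, fun l₁ l₂ c u => ?_, fun l₁ l₂ i j u hu v hv => ?_⟩
    · rcases l₁ with _ | ⟨a, _ | ⟨b, l₁⟩⟩ <;> rcases l₂ with _ | ⟨e, l₂⟩ <;> simp
    · rcases l₁ with _ | ⟨a, _ | ⟨b, l₁⟩⟩ <;> rcases l₂ with _ | ⟨e, l₂⟩ <;> simp
    · rcases l₁ with _ | ⟨a, _ | ⟨b, l₁⟩⟩ <;> simp⟩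
  map_add' x y := by
    ext l; rcases l with _ | ⟨a, _ | ⟨b, l⟩⟩ <;> simp
  map_smul' c x := by
    ext l; rcases l with _ | ⟨a, _ | ⟨b, l⟩⟩ <;> simp

/-! ### Formal vector fields -/

/-- The derivation of `Ŝ W^*` induced by the differential `d` of `W`, evaluated on a list:
`(w_1, …, w_n) ↦ ∑_i (-1)^{|w_1| + ⋯ + |w_{i-1}|} f (w_1, …, d w_i, …, w_n)`. -/
def diffAux (𝒲 : DGSpace k W) : List W → (List W → k) → k
  | [], _ => 0
  | w :: l, f => f (𝒲.d w :: l) + diffAux 𝒲 l (cut (𝒲.invol w) f)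

theorem diffAux_add (𝒲 : DGSpace k W) (l : List W) (f g : List W → k) :
    diffAux 𝒲 l (f + g) = diffAux 𝒲 l f + diffAux 𝒲 l g := by
  induction l generalizing f g with
  | nil => simp [diffAux]
  | cons w l ih => simp only [diffAux, cut_add_fun, ih, Pi.add_apply]; ring

theorem diffAux_smul (𝒲 : DGSpace k W) (l : List W) (c : k) (f : List W → k) :
    diffAux 𝒲 l (c • f) = c * diffAux 𝒲 l f := by
  induction l generalizing f with
  | nil => simp [diffAux]
  | cons w l ih => simp only [diffAux, cut_smul_fun, ih, Pi.smul_apply, smul_eq_mul]; ring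

theorem diffAux_mem (𝒲 : DGSpace k W) {f : List W → k} (hf : f ∈ Form 𝒲) :
    (fun l => diffAux 𝒲 l f) ∈ Form 𝒲 := by
  refine ⟨fun l₁ => ?_, fun l₁ => ?_, fun l₁ => ?_⟩
  · induction l₁ generalizing f with
    | nil =>
      intro l₂ u v
      have h := hf.1 [] l₂ (𝒲.d u) (𝒲.d v)
      simp only [List.nil_append] at h
      simp only [List.nil_append, diffAux, map_add, cut_add hf, diffAux_add, h]
      ring
    | cons w l ih =>
      intro l₂ u v
      have h := hf.1 (𝒲.d w :: l) l₂ u v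
      simp only [List.cons_append] at h
      beta_reduce at ih
      simp only [List.cons_append, diffAux]
      rw [ih (cut_mem _ hf), h]
      ring
  · induction l₁ generalizing f with
    | nil =>
      intro l₂ c u
      have h := hf.2.1 [] l₂ c (𝒲.d u)
      simp only [List.nil_append] at h
      simp only [List.nil_append, diffAux, map_smul, cut_smul hf, diffAux_smul, h]
      ring
    | cons w l ih =>
      intro l₂ c u
      have h := hf.2.1 (𝒲.d w :: l) l₂ c u
      simp only [List.cons_append] at h
      beta_reduce at ih
      simp only [List.cons_append, diffAux]
      rw [ih (cut_mem _ hf), h]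
      ring
  · induction l₁ generalizing f with
    | nil =>
      intro l₂ i j u hu v hv
      have a1 := congrFun (cut_cut hf (𝒲.d_mem i u hu) hv) l₂
      have a2 := congrFun (cut_cut hf hu (𝒲.d_mem j v hv)) l₂
      have a3 := cut_cut hf hu hv
      simp only [List.nil_append, diffAux, 𝒲.invol_of_mem hu, 𝒲.invol_of_mem hv, cut_smul hf,
        cut_smul (cut_mem _ hf), cut_smul_fun, diffAux_smul, a3, Pi.smul_apply, smul_eq_mul]
      simp only [cut, Pi.smul_apply, smul_eq_mul] at a1 a2 ⊢
      rw [a1, a2, add_mul, mul_add, sgn_add, sgn_add, one_mul, mul_one]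
      have h := sgn_mul_self (k := k) i
      have h' := sgn_mul_self (k := k) j
      linear_combination (sgn k (i * j) * f (𝒲.d v :: u :: l₂)) * h
    | cons w l ih =>
      intro l₂ i j u hu v hv
      have h := hf.2.2 (𝒲.d w :: l) l₂ i j u hu v hv
      simp only [List.cons_append] at h
      beta_reduce at ih
      simp only [List.cons_append, diffAux]
      rw [ih (cut_mem _ hf) l₂ i j u hu v hv, h]
      ring

/-- The linear vector field on `W` given by its differential, as an operator on `Ŝ W^*`. -/
def diff (𝒲 : DGSpace k W) : Form 𝒲 →ₗ[k] Form 𝒲 where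
  toFun f := ⟨fun l => diffAux 𝒲 l f.1, diffAux_mem 𝒲 f.2⟩
  map_add' f g := by ext l; exact diffAux_add 𝒲 l f.1 g.1
  map_smul' c f := by ext l; exact diffAux_smul 𝒲 l c f.1

/-- `D` is a formal vector field of parity `p`, that is, a derivation of parity `p` of the graded
algebra `Ŝ W^*`. (For finite-dimensional `W`, derivations are automatically continuous.) -/
structure IsDerivation {𝒲 : DGSpace k W} (p : ZMod 2) (D : Form 𝒲 →ₗ[k] Form 𝒲) : Prop where
  parity : ∀ q f, HasParity q f → HasParity (q + p) (D f)
  leibniz : ∀ q f g, HasParity q f → D (mul f g) = mul (D f) g + sgn k (p * q) • mul f (D g)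

/-- The commutator `D E - (-1)^{p q} E D` of operators of parities `p` and `q`. -/
def bracket {𝒲 : DGSpace k W} (p q : ZMod 2) (D E : Form 𝒲 →ₗ[k] Form 𝒲) :
    Form 𝒲 →ₗ[k] Form 𝒲 :=
  D ∘ₗ E + (-sgn k (p * q)) • (E ∘ₗ D)

/-- The divergence `∇ D = ∑_i (-1)^{|f_i| |x_i|} ∂_{x_i} f_i` of a vector field `D` of parity `p`,
where `f_i = D x_i` has parity `p + |x_i|` and the `x_i` are the coordinates for a basis of `W`
consisting of a basis of its even part and a basis of its odd part. -/
def divergence [FiniteDimensional k W] {𝒲 : DGSpace k W} (p : ZMod 2)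
    (D : Form 𝒲 →ₗ[k] Form 𝒲) : Form 𝒲 :=
  ∑ i : ZMod 2, ∑ j, sgn k ((p + i) * i) •
    deriv 𝒲 (Module.finBasis k (𝒲.part i) j : W)
      (D (lin 𝒲 ((Module.finBasis k (𝒲.part i)).coord j ∘ₗ 𝒲.projOnto i)))

/-- The symmetric multilinear maps `W^{⊗ n} → W` corresponding to a vector field `D`: the vector
`taylor D [w_1, …, w_n]` is determined by `x (taylor D [w_1, …, w_n]) = (D x) (w_1, …, w_n)` for
all `x ∈ W^*`. -/
def taylor [FiniteDimensional k W] {𝒲 : DGSpace k W} (D : Form 𝒲 →ₗ[k] Form 𝒲)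
    (l : List W) : W :=
  (Module.evalEquiv k W).symm
    (LinearMap.proj l ∘ₗ (Form 𝒲).subtype ∘ₗ D ∘ₗ lin 𝒲)

end Forms

/-! ### `L_∞` algebras and unimodularity -/

section LInfty

variable {k V : Type*} [Field k] [AddCommGroup V] [Module k V]

/-- An `L_∞` structure on the dg super vector space `V`: an odd element `m` of
`Der_{≥ 2} (Ŝ ΠV^*)`, that is, an odd derivation sending `ΠV^*` to `Ŝ_{≥ 2} ΠV^*`, that satisfies
the Maurer-Cartan equation `[d, m] + (1/2) [m, m] = 0`. -/
@[ext]
structure LInfty (𝒱 : DGSpace k V) where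
  m : Form 𝒱.shift →ₗ[k] Form 𝒱.shift
  isDerivation : IsDerivation 1 m
  atLeast : ∀ x : Module.Dual k V, AtLeast 2 (m (lin 𝒱.shift x))
  maurerCartan : bracket 1 1 (diff 𝒱.shift) m + (1 / 2 : k) • bracket 1 1 m m = 0

variable [FiniteDimensional k V] {𝒱 : DGSpace k V}

/-- The pair `(m, f)` is a unimodular `L_∞` structure, for an `L_∞` structure `m` and a formal
function `f`: `f` is even and `d f + (1/2) ∇ m + m f = 0`. -/
def LInfty.IsUnimodularWith (L : LInfty 𝒱) (f : Form 𝒱.shift) : Prop :=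
  HasParity 0 f ∧ diff 𝒱.shift f + (1 / 2 : k) • divergence 1 L.m + L.m f = 0

/-- `m` is strictly unimodular: `(m, 0)` is a unimodular `L_∞` structure. -/
def LInfty.StrictlyUnimodular (L : LInfty 𝒱) : Prop := L.IsUnimodularWith 0

/-- `m` lifts to a unimodular `L_∞` structure `(m, f)`. -/
def LInfty.AdmitsUnimodularLift (L : LInfty 𝒱) : Prop := ∃ f, L.IsUnimodularWith f

end LInfty

/-! ### Tensor products of a cdga and an `L_∞` algebra -/

/-- The exponent of the Koszul sign that arises when, in the expression
`ξ a_1 v_1 a_2 v_2 ⋯ a_n v_n`, all of the `a_i` are moved to the left of `ξ` and of all the `v_j`.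
The list consists of the pairs of parities `(|a_i|, |v_i|)`, and `s` is the parity of `ξ`. -/
def koszul : ZMod 2 → List (ZMod 2 × ZMod 2) → ZMod 2
  | _, [] => 0
  | s, (α, β) :: l => s * α + koszul (s + β) l

/-- `M` is the tensor product `L_∞` structure on `A ⊗ V`: its multilinear maps are
`X^n ⊗ m_n`, where `X^n` is the `n`-fold product of `A` and `m_n` are the multilinear maps
`(ΠV)^{⊗ n} → ΠV` of the `L_∞` algebra `V`, with the sign given by the Koszul rule. -/
def IsTensorProduct {k A V : Type*} [Field k] [CharZero k] [Ring A] [Algebra k A]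
    [FiniteDimensional k A] [AddCommGroup V] [Module k V] [FiniteDimensional k V]
    (𝒜 : CDGA k A) {𝒱 : DGSpace k V} (L : LInfty 𝒱) (M : LInfty (𝒜.toDGSpace.tensor 𝒱)) : Prop :=
  ∀ (l : List (A × V)) (s : List (ZMod 2 × ZMod 2)),
    List.Forall₂ (fun x p => x.1 ∈ 𝒜.part p.1 ∧ x.2 ∈ 𝒱.shift.part p.2) l s →
    taylor M.m (l.map fun x => x.1 ⊗ₜ[k] x.2) =
      sgn k (koszul 1 s) • ((l.map Prod.fst).prod ⊗ₜ[k] taylor L.m (l.map Prod.snd))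

end SuperLInfty

end

noncomputable section

namespace SuperLInfty

/-! ### Homogeneous vectors and parity involutions -/

section Space

variable {k V : Type*} [Field k] [AddCommGroup V] [Module k V]

/-! A linear function `φ` on `A` and a formal function `g` on `ΠV` combine to the function `star φ
g` on `Π(A ⊗ V)`, `(a₁ ⊗ v₁, …) ↦ ± φ(a₁⋯aₙ) g(v₁, …, vₙ)`; suitable linear coordinates on `A ⊗ V`
are of this kind. The structure on `A ⊗ V` is the odd derivation sending `star φ g` to `± star φ (m
g)` (`HomFrame.tensorField_star`). The differential acts on `star φ g` by a Leibniz rule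
(`diff_star`), so the Maurer-Cartan equation is inherited from `V`. A derivation is determined by
its values on coordinates, whence uniqueness.

Let `τ(a) = Tr(x ↦ ax)` (`mulTrace`). Contracting the index of `A` in the divergence yields the key
formula `∇(m_{A ⊗ V}) = star τ (∇m)` (`divergence_tensorLInfty`). As `∇m` has no constant term, the
right side vanishes only if `τ` or `∇m` does: this is the strict statement. For lifts, `τ` is even
and vanishes on exact elements, so `star τ f` is a lift whenever `f` is one.

Conversely, if `τ ≠ 0` there is an even idempotent `e` with `τ(e) ≠ 0` (`CDGA.exists_idempotent`).
It is closed, so `v ↦ e ⊗ v` respects differentials and `L_∞` structures. Because `eⁿ = e` for `n ≥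
1`, pullback along it turns `star τ (∇m)` into `τ(e) ∇m`; a lift on `A ⊗ V`, pulled back and divided
by `τ(e)`, is a lift on `V`.

The idempotent comes from the commutative algebra `A₀`. Factoring the minimal polynomial of `a ∈ A₀`
into powers of irreducibles splits `1` into idempotents `e`. On `eA` the trace of `a` is a multiple
of the dimension, with the same factor in both parities, so `τ(ae)` is a multiple of `τ(e)`. If `τ`
vanishes on all even idempotents, it vanishes on `A₀`; on odd elements it vanishes anyway. -/

theorem zmod_two_one_add_one : (1 + 1 : ZMod 2) = 0 := by decide

@[simp] theorem sgn_zero : sgn k 0 = 1 := by simp [sgn]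

@[simp] theorem sgn_one : sgn k 1 = -1 := by simp [sgn]

theorem sgn_injective [CharZero k] {i j : ZMod 2} (h : sgn k i = sgn k j) : i = j := by
  have h2 : (2 : k) ≠ 0 := two_ne_zero
  rcases zmod_two_cases i with rfl | rfl <;> rcases zmod_two_cases j with rfl | rfl
  · rfl
  · simp only [sgn_zero, sgn_one] at h; exact absurd (by linear_combination h) h2
  · simp only [sgn_zero, sgn_one] at h; exact absurd (by linear_combination -h) h2
  · rfl

/-- The `i`-th power of the parity involution. -/
def DGSpace.tw (𝒱 : DGSpace k V) (i : ZMod 2) : V →ₗ[k] V :=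
  if i = 0 then LinearMap.id else 𝒱.invol

theorem DGSpace.tw_of_mem (𝒱 : DGSpace k V) (i : ZMod 2) {j : ZMod 2} {v : V}
    (hv : v ∈ 𝒱.part j) : 𝒱.tw i v = sgn k (i * j) • v := by
  rcases zmod_two_cases i with rfl | rfl
  · simp [DGSpace.tw]
  · simp [DGSpace.tw, 𝒱.invol_of_mem hv]

@[simp] theorem DGSpace.tw_zero (𝒱 : DGSpace k V) : 𝒱.tw 0 = LinearMap.id := by
  simp [DGSpace.tw]

theorem DGSpace.tw_one (𝒱 : DGSpace k V) : 𝒱.tw 1 = 𝒱.invol := by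
  simp [DGSpace.tw]

theorem DGSpace.induction_homog (𝒱 : DGSpace k V) {P : V → Prop}
    (hom : ∀ i, ∀ v ∈ 𝒱.part i, P v) (add : ∀ u v, P u → P v → P (u + v)) (v : V) : P v := by
  obtain ⟨a, ha, b, hb, rfl⟩ := 𝒱.exists_add v
  exact add _ _ (hom 0 a ha) (hom 1 b hb)

theorem DGSpace.hom_ext (𝒱 : DGSpace k V) {U : Type*} [AddCommGroup U] [Module k U]
    {f g : V →ₗ[k] U} (h : ∀ i, ∀ v ∈ 𝒱.part i, f v = g v) : f = g := by
  refine LinearMap.ext fun v => ?_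
  induction v using 𝒱.induction_homog with
  | hom i v hv => exact h i v hv
  | add u v hu hv => rw [map_add, map_add, hu, hv]

theorem DGSpace.tw_tw (𝒱 : DGSpace k V) (i j : ZMod 2) (v : V) :
    𝒱.tw i (𝒱.tw j v) = 𝒱.tw (i + j) v := by
  induction v using 𝒱.induction_homog with
  | hom l v hv =>
    rw [𝒱.tw_of_mem j hv, map_smul, 𝒱.tw_of_mem i hv, 𝒱.tw_of_mem _ hv, smul_smul, ← sgn_add]
    congr 2; ring
  | add u v hu hv => simp only [map_add, hu, hv]

theorem DGSpace.d_tw (𝒱 : DGSpace k V) (i : ZMod 2) (v : V) :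
    𝒱.d (𝒱.tw i v) = sgn k i • 𝒱.tw i (𝒱.d v) := by
  induction v using 𝒱.induction_homog with
  | hom l v hv =>
    rw [𝒱.tw_of_mem i hv, map_smul, 𝒱.tw_of_mem i (𝒱.d_mem l v hv), smul_smul, ← sgn_add]
    congr 2
    exact (by decide : ∀ i l : ZMod 2, i * l = i + i * (l + 1)) i l
  | add u v hu hv => simp only [map_add, hu, hv, smul_add]

theorem DGSpace.proj_add_proj (𝒱 : DGSpace k V) (v : V) : 𝒱.proj 0 v + 𝒱.proj 1 v = v := by
  induction v using 𝒱.induction_homog with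
  | hom l v hv =>
    rcases zmod_two_cases l with rfl | rfl
    · rw [𝒱.proj_self hv, 𝒱.proj_other (by rw [zmod_two_one_add_one]; exact hv), add_zero]
    · rw [𝒱.proj_self hv, 𝒱.proj_other (by simpa using hv), zero_add]
  | add u v hu hv =>
    rw [map_add, map_add, add_add_add_comm, hu, hv]

end Space

/-! ### The calculus of formal functions -/

section Forms

variable {k W : Type*} [Field k] [AddCommGroup W] [Module k W] {𝒲 : DGSpace k W}

theorem form_cons (f : Form 𝒲) (w : W) (l : List W) :
    f.1 (w :: l) = (deriv 𝒲 w f).1 l := rfl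

/-- Multilinearity reduces to homogeneous arguments, where signs make sense. Most identities below
follow by induction on the list of arguments: by `form_cons` the first argument becomes a partial
derivative, whose commutation with the operation at hand is known. -/
theorem form_ext_homog {f g : Form 𝒲}
    (h : ∀ l : List W, (∀ w ∈ l, ∃ i, w ∈ 𝒲.part i) → f.1 l = g.1 l) : f = g := by
  refine Subtype.ext (funext fun l => ?_)
  induction l generalizing f g with
  | nil => exact h [] (by simp)
  | cons w l ih =>
    obtain ⟨a, ha, b, hb, rfl⟩ := 𝒲.exists_add w
    have key : ∀ i, ∀ w ∈ 𝒲.part i, f.1 (w :: l) = g.1 (w :: l) := by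
      intro i w hw
      refine ih (f := deriv 𝒲 w f) (g := deriv 𝒲 w g) fun l hl => h (w :: l) ?_
      intro u hu
      rcases List.mem_cons.mp hu with rfl | hu
      · exact ⟨i, hw⟩
      · exact hl u hu
    have e1 := f.2.1 [] l a b
    have e2 := g.2.1 [] l a b
    simp only [List.nil_append] at e1 e2
    rw [e1, e2, key 0 a ha, key 1 b hb]

theorem deriv_add (u v : W) (f : Form 𝒲) : deriv 𝒲 (u + v) f = deriv 𝒲 u f + deriv 𝒲 v f :=
  Subtype.ext (cut_add f.2 u v)

theorem deriv_smul (c : k) (u : W) (f : Form 𝒲) : deriv 𝒲 (c • u) f = c • deriv 𝒲 u f :=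
  Subtype.ext (cut_smul f.2 c u)

/-- The partial derivative, as a linear function of the direction. -/
def derivL (𝒲 : DGSpace k W) : W →ₗ[k] Form 𝒲 →ₗ[k] Form 𝒲 where
  toFun := deriv 𝒲
  map_add' u v := LinearMap.ext fun f => deriv_add u v f
  map_smul' c u := LinearMap.ext fun f => deriv_smul c u f

theorem derivL_apply (w : W) (f : Form 𝒲) : derivL 𝒲 w f = deriv 𝒲 w f := rfl

theorem deriv_sum {ι : Type*} (s : Finset ι) (e : ι → W) (f : Form 𝒲) :
    deriv 𝒲 (∑ i ∈ s, e i) f = ∑ i ∈ s, deriv 𝒲 (e i) f := by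
  simp only [← derivL_apply, map_sum, LinearMap.sum_apply]

theorem deriv_deriv {i j : ZMod 2} {u v : W} (hu : u ∈ 𝒲.part i) (hv : v ∈ 𝒲.part j)
    (f : Form 𝒲) : deriv 𝒲 v (deriv 𝒲 u f) = sgn k (i * j) • deriv 𝒲 u (deriv 𝒲 v f) :=
  Subtype.ext (cut_cut f.2 hu hv)

/-- The `i`-th power of the parity involution of `Ŝ W^*`. -/
def formTw (𝒲 : DGSpace k W) (i : ZMod 2) : Form 𝒲 →ₗ[k] Form 𝒲 where
  toFun f := ⟨twist 𝒲 i f.1, twist_mem i f.2⟩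
  map_add' f g := Subtype.ext (twist_add 𝒲 i f.1 g.1)
  map_smul' c f := Subtype.ext (twist_smul 𝒲 i c f.1)

@[simp] theorem formTw_zero (f : Form 𝒲) : formTw 𝒲 0 f = f := by
  refine Subtype.ext ?_
  simp [formTw, twist]

theorem formTw_nil (i : ZMod 2) (f : Form 𝒲) : (formTw 𝒲 i f).1 [] = f.1 [] := by
  simp only [formTw, twist, LinearMap.coe_mk, AddHom.coe_mk]
  split_ifs <;> simp

theorem formTw_apply (i : ZMod 2) (f : Form 𝒲) (l : List W) :
    (formTw 𝒲 i f).1 l = f.1 (l.map (𝒲.tw i)) := by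
  simp only [formTw, twist, LinearMap.coe_mk, AddHom.coe_mk, DGSpace.tw]
  split_ifs <;> simp

theorem deriv_formTw (i : ZMod 2) {j : ZMod 2} {w : W} (hw : w ∈ 𝒲.part j) (f : Form 𝒲) :
    deriv 𝒲 w (formTw 𝒲 i f) = sgn k (i * j) • formTw 𝒲 i (deriv 𝒲 w f) :=
  Subtype.ext (cut_twist 𝒲 hw f.2)

theorem formTw_deriv (i : ZMod 2) {j : ZMod 2} {w : W} (hw : w ∈ 𝒲.part j) (f : Form 𝒲) :
    formTw 𝒲 i (deriv 𝒲 w f) = sgn k (i * j) • deriv 𝒲 w (formTw 𝒲 i f) := by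
  rw [deriv_formTw i hw, smul_smul, sgn_mul_self, one_smul]

theorem formTw_formTw (i j : ZMod 2) (f : Form 𝒲) :
    formTw 𝒲 i (formTw 𝒲 j f) = formTw 𝒲 (i + j) f := by
  refine Subtype.ext (funext fun l => ?_)
  have h : 𝒲.tw j ∘ 𝒲.tw i = 𝒲.tw (i + j) := funext fun w => by
    rw [Function.comp_apply, 𝒲.tw_tw, add_comm]
  simp only [formTw_apply, List.map_map, h]

theorem formTw_of_forall₂ (f : Form 𝒲) {l : List W} {s : List (ZMod 2)}
    (h : List.Forall₂ (fun w i => w ∈ 𝒲.part i) l s) (i : ZMod 2) :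
    (formTw 𝒲 i f).1 l = sgn k (i * s.sum) * f.1 l := by
  induction h generalizing f with
  | nil => simp [formTw_nil]
  | @cons w j l s hw _ ih =>
    rw [form_cons, deriv_formTw i hw, Submodule.coe_smul, Pi.smul_apply, ih, smul_eq_mul,
      List.sum_cons, mul_add, sgn_add, form_cons, mul_assoc]

theorem exists_forall₂ {l : List W} (h : ∀ w ∈ l, ∃ i, w ∈ 𝒲.part i) :
    ∃ s : List (ZMod 2), List.Forall₂ (fun w i => w ∈ 𝒲.part i) l s := by
  induction l with
  | nil => exact ⟨[], .nil⟩
  | cons w l ih =>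
    obtain ⟨i, hi⟩ := h w (by simp)
    obtain ⟨s, hs⟩ := ih fun u hu => h u (by simp [hu])
    exact ⟨i :: s, .cons hi hs⟩

theorem HasParity.formTw {q : ZMod 2} {f : Form 𝒲} (h : HasParity q f) (i : ZMod 2) :
    formTw 𝒲 i f = sgn k (i * q) • f := by
  refine form_ext_homog fun l hl => ?_
  obtain ⟨s, hs⟩ := exists_forall₂ hl
  rw [formTw_of_forall₂ f hs, Submodule.coe_smul, Pi.smul_apply, smul_eq_mul]
  by_cases hq : s.sum = q
  · rw [hq]
  · rw [h l s hs hq, mul_zero, mul_zero]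

/-- Since `1 ≠ -1`, the two parities are separated by the eigenvalues of the parity involution;
parity thus becomes a linear equation. -/
theorem hasParity_iff [CharZero k] {q : ZMod 2} {f : Form 𝒲} :
    HasParity q f ↔ formTw 𝒲 1 f = sgn k q • f := by
  refine ⟨fun h => by simpa using h.formTw 1, fun h l s hs hq => ?_⟩
  have e := formTw_of_forall₂ f hs 1
  rw [h, Submodule.coe_smul, Pi.smul_apply, smul_eq_mul, one_mul, ← sub_eq_zero,
    ← sub_mul] at e
  exact (mul_eq_zero.mp e).resolve_left fun h => hq (sgn_injective (sub_eq_zero.mp h)).symm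

theorem HasParity.deriv [CharZero k] {q i : ZMod 2} {f : Form 𝒲} (h : HasParity q f) {w : W}
    (hw : w ∈ 𝒲.part i) : HasParity (q + i) (deriv 𝒲 w f) := by
  rw [hasParity_iff, formTw_deriv 1 hw, h.formTw, map_smul, smul_smul, one_mul, one_mul,
    add_comm, sgn_add]

theorem HasParity.smul {q : ZMod 2} {f : Form 𝒲} (c : k) (hf : HasParity q f) :
    HasParity q (c • f) := fun l s hs hq => by
  rw [Submodule.coe_smul, Pi.smul_apply, hf l s hs hq, smul_zero]

theorem exists_add_parity [CharZero k] (f : Form 𝒲) :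
    ∃ g h, HasParity 0 g ∧ HasParity 1 h ∧ g + h = f := by
  refine ⟨(1 / 2 : k) • (f + formTw 𝒲 1 f), (1 / 2 : k) • (f - formTw 𝒲 1 f), ?_, ?_, ?_⟩
  · rw [hasParity_iff]
    simp only [map_smul, map_add, formTw_formTw, zmod_two_one_add_one, formTw_zero, sgn_zero,
      one_smul, add_comm]
  · rw [hasParity_iff]
    simp only [map_smul, map_sub, formTw_formTw, zmod_two_one_add_one, formTw_zero, sgn_one]
    module
  · module

theorem form_hom_ext [CharZero k] {U : Type*} [AddCommGroup U] [Module k U]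
    {D E : Form 𝒲 →ₗ[k] U} (h : ∀ q f, HasParity q f → D f = E f) : D = E := by
  refine LinearMap.ext fun f => ?_
  obtain ⟨a, b, ha, hb, rfl⟩ := exists_add_parity f
  rw [map_add, map_add, h 0 a ha, h 1 b hb]

/-! ### The product -/

/-- The product of `Ŝ W^*`, as a bilinear map. -/
def mulL (𝒲 : DGSpace k W) : Form 𝒲 →ₗ[k] Form 𝒲 →ₗ[k] Form 𝒲 :=
  LinearMap.mk₂ k mul
    (fun f f' g => Subtype.ext (funext fun l => mulAux_add_left 𝒲 l f.1 f'.1 g.1))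
    (fun c f g => Subtype.ext (funext fun l => mulAux_smul_left 𝒲 l c f.1 g.1))
    (fun f g g' => Subtype.ext (funext fun l => mulAux_add_right 𝒲 l f.1 g.1 g'.1))
    (fun c f g => Subtype.ext (funext fun l => mulAux_smul_right 𝒲 l c f.1 g.1))

theorem mulL_apply (f g : Form 𝒲) : mulL 𝒲 f g = mul f g := rfl

theorem mul_add_left (f f' g : Form 𝒲) : mul (f + f') g = mul f g + mul f' g := by
  simp only [← mulL_apply, map_add, LinearMap.add_apply]

theorem mul_add_right (f g g' : Form 𝒲) : mul f (g + g') = mul f g + mul f g' := by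
  simp only [← mulL_apply, map_add]

theorem mul_smul_left (c : k) (f g : Form 𝒲) : mul (c • f) g = c • mul f g := by
  simp only [← mulL_apply, map_smul, LinearMap.smul_apply]

theorem mul_smul_right (c : k) (f g : Form 𝒲) : mul f (c • g) = c • mul f g := by
  simp only [← mulL_apply, map_smul]

theorem mul_zero_left (g : Form 𝒲) : mul 0 g = 0 := by
  simp only [← mulL_apply, map_zero, LinearMap.zero_apply]

theorem mul_zero_right (g : Form 𝒲) : mul g 0 = 0 := by
  simp only [← mulL_apply, map_zero]

theorem mul_sum_left {ι : Type*} (s : Finset ι) (f : ι → Form 𝒲) (g : Form 𝒲) :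
    mul (∑ i ∈ s, f i) g = ∑ i ∈ s, mul (f i) g := by
  simp only [← mulL_apply, map_sum, LinearMap.sum_apply]

theorem mul_sum_right {ι : Type*} (s : Finset ι) (f : ι → Form 𝒲) (g : Form 𝒲) :
    mul g (∑ i ∈ s, f i) = ∑ i ∈ s, mul g (f i) := by
  simp only [← mulL_apply, map_sum]

theorem mul_nil (f g : Form 𝒲) : (mul f g).1 [] = f.1 [] * g.1 [] := rfl

theorem deriv_mul {i : ZMod 2} {w : W} (hw : w ∈ 𝒲.part i) (f g : Form 𝒲) :
    deriv 𝒲 w (mul f g) = mul (deriv 𝒲 w f) g + mul (formTw 𝒲 i f) (deriv 𝒲 w g) :=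
  Subtype.ext (funext fun l => mulAux_cons_homog 𝒲 hw l f.1 g.2)

theorem formTw_mul (i : ZMod 2) (f g : Form 𝒲) :
    formTw 𝒲 i (mul f g) = mul (formTw 𝒲 i f) (formTw 𝒲 i g) := by
  refine form_ext_homog fun l hl => ?_
  induction l generalizing f g with
  | nil => simp only [mul_nil, formTw_nil]
  | cons w l ih =>
    obtain ⟨j, hj⟩ := hl w (by simp)
    have ih' := fun f g => ih f g fun u hu => hl u (by simp [hu])
    simp only [form_cons, deriv_formTw i hj, deriv_mul hj, map_add, Submodule.coe_add,
      Submodule.coe_smul, Pi.add_apply, Pi.smul_apply, ih', mul_smul_left, mul_smul_right,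
      smul_add, formTw_formTw, add_comm i j]

theorem mul_assoc (f g h : Form 𝒲) : mul (mul f g) h = mul f (mul g h) := by
  refine form_ext_homog fun l hl => ?_
  induction l generalizing f g h with
  | nil => simp only [mul_nil, _root_.mul_assoc]
  | cons w l ih =>
    obtain ⟨j, hj⟩ := hl w (by simp)
    have ih' := fun f g h => ih f g h fun u hu => hl u (by simp [hu])
    simp only [form_cons, deriv_mul hj, mul_add_left, mul_add_right, Submodule.coe_add,
      Pi.add_apply, ih', formTw_mul, add_assoc]

/-- Supercommutativity, with the sign absorbed into the twist so that `f` need not be homogeneous.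
-/
theorem mul_eq_mul_formTw [CharZero k] {q : ZMod 2} (f : Form 𝒲) {g : Form 𝒲}
    (hg : HasParity q g) : mul f g = mul g (formTw 𝒲 q f) := by
  refine form_ext_homog fun l hl => ?_
  induction l generalizing f g q with
  | nil => simp only [mul_nil, formTw_nil, mul_comm]
  | cons w l ih =>
    obtain ⟨j, hj⟩ := hl w (by simp)
    have hl' : ∀ u ∈ l, ∃ i, u ∈ 𝒲.part i := fun u hu => hl u (by simp [hu])
    simp only [form_cons, deriv_mul hj, Submodule.coe_add, Pi.add_apply]
    have h1 : q + j + j = q := (by decide : ∀ q j : ZMod 2, q + j + j = q) q j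
    have h2 : j * q + q * j = 0 := (by decide : ∀ q j : ZMod 2, j * q + q * j = 0) q j
    rw [ih (deriv 𝒲 w f) hg hl', ih (formTw 𝒲 j f) (hg.deriv hj) hl', hg.formTw,
      deriv_formTw q hj, formTw_formTw, mul_smul_left, mul_smul_right, smul_smul, ← sgn_add,
      add_comm, h1, h2, sgn_zero, one_smul]

/-- The constant functions. -/
def const (𝒲 : DGSpace k W) (c : k) : Form 𝒲 :=
  ⟨fun l => if l = [] then c else 0, by
    refine ⟨fun l₁ l₂ u v => ?_, fun l₁ l₂ c u => ?_, fun l₁ l₂ i j u hu v hv => ?_⟩ <;> simp⟩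

theorem deriv_const (w : W) (c : k) : deriv 𝒲 w (const 𝒲 c) = 0 := by
  refine Subtype.ext (funext fun l => ?_)
  change (const 𝒲 c).1 (w :: l) = 0
  simp [const]

theorem deriv_lin (w : W) (x : Module.Dual k W) :
    deriv 𝒲 w (lin 𝒲 x) = const 𝒲 (x w) := by
  refine Subtype.ext (funext fun l => ?_)
  change (lin 𝒲 x).1 (w :: l) = _
  rcases l with _ | ⟨u, l⟩ <;> simp [const, lin]

theorem lin_nil (x : Module.Dual k W) : (lin 𝒲 x).1 [] = 0 := rfl

theorem formTw_const (i : ZMod 2) (c : k) : formTw 𝒲 i (const 𝒲 c) = const 𝒲 c := by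
  refine Subtype.ext (funext fun l => ?_)
  simp [formTw_apply, const]

theorem const_mul (c : k) (f : Form 𝒲) : mul (const 𝒲 c) f = c • f := by
  refine form_ext_homog fun l hl => ?_
  induction l generalizing f with
  | nil => simp [mul_nil, const]
  | cons w l ih =>
    obtain ⟨j, hj⟩ := hl w (by simp)
    simp only [form_cons, deriv_mul hj, deriv_const, mul_zero_left, zero_add, formTw_const,
      ih _ fun u hu => hl u (by simp [hu]), map_smul]

theorem mul_const (c : k) (f : Form 𝒲) : mul f (const 𝒲 c) = c • f := by
  refine form_ext_homog fun l hl => ?_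
  induction l generalizing f with
  | nil => simp [mul_nil, const, mul_comm]
  | cons w l ih =>
    obtain ⟨j, hj⟩ := hl w (by simp)
    simp only [form_cons, deriv_mul hj, deriv_const, mul_zero_right, add_zero,
      ih _ fun u hu => hl u (by simp [hu]), map_smul]

theorem lin_hasParity {x : Module.Dual k W} {q : ZMod 2}
    (h : ∀ w ∈ 𝒲.part (q + 1), x w = 0) : HasParity q (lin 𝒲 x) := by
  intro l s hs hq
  rcases hs with _ | ⟨hw, _ | _⟩
  · rfl
  · rename_i w i
    have : i = q + 1 := (by decide : ∀ i q : ZMod 2, i ≠ q → i = q + 1) i q (by simpa using hq)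
    subst this
    exact h _ hw
  · rfl

theorem AtLeast.deriv {n : ℕ} {f : Form 𝒲} (h : AtLeast (n + 1) f) (w : W) :
    AtLeast n (deriv 𝒲 w f) := fun l hl => h (w :: l) (by simpa using hl)

theorem AtLeast.mono {m n : ℕ} {f : Form 𝒲} (h : AtLeast n f) (hmn : m ≤ n) : AtLeast m f :=
  fun l hl => h l (hl.trans_le hmn)

theorem AtLeast.smul {n : ℕ} {f : Form 𝒲} (c : k) (h : AtLeast n f) : AtLeast n (c • f) :=
  fun l hl => by rw [Submodule.coe_smul, Pi.smul_apply, h l hl, smul_zero]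

theorem AtLeast.add {n : ℕ} {f g : Form 𝒲} (hf : AtLeast n f) (hg : AtLeast n g) :
    AtLeast n (f + g) :=
  fun l hl => by rw [Submodule.coe_add, Pi.add_apply, hf l hl, hg l hl, add_zero]

theorem AtLeast.sum {n : ℕ} {ι : Type*} (s : Finset ι) {f : ι → Form 𝒲}
    (hf : ∀ i ∈ s, AtLeast n (f i)) : AtLeast n (∑ i ∈ s, f i) :=
  Finset.sum_induction f (AtLeast n) (fun _ _ => AtLeast.add) (fun _ _ => rfl) hf

theorem lin_mul_atLeast (x : Module.Dual k W) (g : Form 𝒲) (n : ℕ) (hg : AtLeast n g) :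
    AtLeast (n + 1) (mul (lin 𝒲 x) g) := by
  -- The Leibniz rule replaces `lin y` by its twist, another linear function, so the induction runs
  -- over all linear functions at once.
  have key : ∀ l : List W, ∀ (y : Module.Dual k W) (h : Form 𝒲) (n : ℕ), AtLeast n h →
      l.length < n + 1 → (mul (lin 𝒲 y) h).1 l = 0 := by
    intro l
    induction l with
    | nil => intro y h n _ _; rw [mul_nil, lin_nil, zero_mul]
    | cons w l ih =>
      intro y h n hh hl
      obtain ⟨m, rfl⟩ : ∃ m, n = m + 1 := ⟨n - 1, by simp at hl; omega⟩
      have hom : ∀ i, ∀ w ∈ 𝒲.part i, (mul (lin 𝒲 y) h).1 (w :: l) = 0 := by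
        intro i w hw
        have e : formTw 𝒲 i (lin 𝒲 y) = lin 𝒲 (y ∘ₗ 𝒲.tw i) := by
          refine Subtype.ext (funext fun l => ?_)
          rw [formTw_apply]
          rcases l with _ | ⟨a, _ | ⟨b, l⟩⟩ <;> simp [lin]
        rw [form_cons, deriv_mul hw, deriv_lin, const_mul, Submodule.coe_add, Pi.add_apply,
          Submodule.coe_smul, Pi.smul_apply, hh l (by simpa using hl), e,
          ih _ _ m (hh.deriv w) (by simpa using hl), smul_zero, add_zero]
      obtain ⟨a, ha, b, hb, rfl⟩ := 𝒲.exists_add w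
      have e1 := (mul (lin 𝒲 y) h).2.1 [] l a b
      simp only [List.nil_append] at e1
      rw [e1, hom 0 a ha, hom 1 b hb, add_zero]
  exact fun l hl => key l x g n hg hl

/-! ### The differential -/

theorem diff_nil (f : Form 𝒲) : (diff 𝒲 f).1 [] = 0 := rfl

theorem deriv_diff {i : ZMod 2} {w : W} (hw : w ∈ 𝒲.part i) (f : Form 𝒲) :
    deriv 𝒲 w (diff 𝒲 f) = deriv 𝒲 (𝒲.d w) f + sgn k i • diff 𝒲 (deriv 𝒲 w f) := by
  refine Subtype.ext (funext fun l => ?_)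
  change f.1 (𝒲.d w :: l) + diffAux 𝒲 l (cut (𝒲.invol w) f.1) =
    f.1 (𝒲.d w :: l) + sgn k i * diffAux 𝒲 l (cut w f.1)
  rw [𝒲.invol_of_mem hw, cut_smul f.2, diffAux_smul]

theorem formTw_diff (i : ZMod 2) (f : Form 𝒲) :
    formTw 𝒲 i (diff 𝒲 f) = sgn k i • diff 𝒲 (formTw 𝒲 i f) := by
  refine form_ext_homog fun l hl => ?_
  induction l generalizing f with
  | nil => simp [formTw_nil, diff_nil]
  | cons w l ih =>
    obtain ⟨j, hj⟩ := hl w (by simp)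
    have ih' := fun f => ih f fun u hu => hl u (by simp [hu])
    simp only [form_cons, deriv_formTw i hj, deriv_diff hj, map_add, map_smul,
      Submodule.coe_add, Submodule.coe_smul, Pi.add_apply, Pi.smul_apply, ih',
      formTw_deriv i (𝒲.d_mem j w hj), mul_add, sgn_add, smul_eq_mul, mul_one]
    have h := sgn_mul_self (k := k) (i * j)
    linear_combination (sgn k i * (deriv 𝒲 (𝒲.d w) (formTw 𝒲 i f)).1 l) * h

theorem diff_mul (f g : Form 𝒲) :
    diff 𝒲 (mul f g) = mul (diff 𝒲 f) g + mul (formTw 𝒲 1 f) (diff 𝒲 g) := by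
  refine form_ext_homog fun l hl => ?_
  induction l generalizing f g with
  | nil => simp [mul_nil, diff_nil]
  | cons w l ih =>
    obtain ⟨j, hj⟩ := hl w (by simp)
    have ih' := fun f g => ih f g fun u hu => hl u (by simp [hu])
    simp only [form_cons, deriv_diff hj, deriv_mul hj, deriv_mul (𝒲.d_mem j w hj), map_add,
      Submodule.coe_add, Submodule.coe_smul, Pi.add_apply, Pi.smul_apply, ih',
      deriv_formTw 1 hj, mul_add_left, mul_add_right, mul_smul_left, mul_smul_right,
      formTw_formTw, formTw_diff j, one_mul, smul_eq_mul, add_comm 1 j]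
    ring

end Forms

/-! ### Homogeneous coordinates -/

/-- Homogeneous vectors `e i` of parity `p i` and coordinates `x i` of the same parity, such that
every vector is `∑ i, x i w • e i`. -/
structure HomFrame {k W : Type*} [Field k] [AddCommGroup W] [Module k W] (𝒲 : DGSpace k W)
    (ι : Type*) [Fintype ι] where
  p : ι → ZMod 2
  e : ι → W
  x : ι → Module.Dual k W
  e_mem : ∀ i, e i ∈ 𝒲.part (p i)
  x_eq_zero : ∀ i, ∀ w ∈ 𝒲.part (p i + 1), x i w = 0
  sum_eq : ∀ w, ∑ i, x i w • e i = w

section Forms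

variable {k W : Type*} [Field k] [AddCommGroup W] [Module k W] {𝒲 : DGSpace k W}

theorem DGSpace.proj_eq_sum [FiniteDimensional k W] (𝒲 : DGSpace k W) (i : ZMod 2) (w : W) :
    ∑ j, ((Module.finBasis k (𝒲.part i)).coord j ∘ₗ 𝒲.projOnto i) w •
      (Module.finBasis k (𝒲.part i) j : W) = 𝒲.proj i w := by
  have h := congrArg (𝒲.part i).subtype
    ((Module.finBasis k (𝒲.part i)).sum_repr (𝒲.projOnto i w))
  rw [map_sum] at h
  exact h

/-- The frame used in the definition of the divergence. -/
def stdFrame [FiniteDimensional k W] (𝒲 : DGSpace k W) :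
    HomFrame 𝒲 (Σ i : ZMod 2, Fin (Module.finrank k (𝒲.part i))) where
  p a := a.1
  e a := Module.finBasis k (𝒲.part a.1) a.2
  x a := (Module.finBasis k (𝒲.part a.1)).coord a.2 ∘ₗ 𝒲.projOnto a.1
  e_mem a := (Module.finBasis k (𝒲.part a.1) a.2).2
  x_eq_zero a w hw := by
    have h : 𝒲.projOnto a.1 w = 0 := Subtype.ext (𝒲.proj_other hw)
    simp [h]
  sum_eq w := by
    rw [Fintype.sum_sigma]
    simp only [DGSpace.proj_eq_sum]
    exact (Fin.sum_univ_two fun i : ZMod 2 => 𝒲.proj i w).trans (𝒲.proj_add_proj w)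

variable {ι : Type*} [Fintype ι] (B : HomFrame 𝒲 ι)

theorem HomFrame.dual_eq (y : Module.Dual k W) : y = ∑ i, y (B.e i) • B.x i := by
  refine LinearMap.ext fun w => ?_
  conv_lhs => rw [← B.sum_eq w]
  simp only [map_sum, map_smul, LinearMap.sum_apply, LinearMap.smul_apply, smul_eq_mul, mul_comm]

theorem HomFrame.parity_eq (i : ι) {j : ZMod 2} {w : W} (hw : w ∈ 𝒲.part j)
    (h : B.x i w ≠ 0) : j = B.p i := by
  by_contra hne
  have e : j = B.p i + 1 := (by decide : ∀ a b : ZMod 2, a ≠ b → a = b + 1) _ _ hne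
  subst e
  exact h (B.x_eq_zero i w hw)

theorem HomFrame.x_tw (i : ι) (j : ZMod 2) (w : W) :
    B.x i (𝒲.tw j w) = sgn k (j * B.p i) * B.x i w := by
  induction w using 𝒲.induction_homog with
  | hom l w hw =>
    rw [𝒲.tw_of_mem j hw, map_smul, smul_eq_mul]
    by_cases h : B.x i w = 0
    · rw [h, mul_zero, mul_zero]
    · rw [B.parity_eq i hw h]
  | add u v hu hv => simp only [map_add, hu, hv, mul_add]

theorem HomFrame.lin_parity (i : ι) : HasParity (B.p i) (lin 𝒲 (B.x i)) :=
  lin_hasParity (B.x_eq_zero i)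

theorem HomFrame.deriv_eq (w : W) (f : Form 𝒲) :
    deriv 𝒲 w f = ∑ i, B.x i w • deriv 𝒲 (B.e i) f := by
  conv_lhs => rw [← B.sum_eq w, deriv_sum]
  simp only [deriv_smul]

/-- The Euler vector field `∑ x_i ∂_i` multiplies homogeneous polynomials by their degree. -/
theorem HomFrame.euler (f : Form 𝒲) (l : List W) :
    (∑ i, mul (lin 𝒲 (B.x i)) (deriv 𝒲 (B.e i) f)).1 l = l.length * f.1 l := by
  let N : Form 𝒲 →ₗ[k] Form 𝒲 :=
    { toFun := fun f => ⟨fun l => l.length * f.1 l, by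
        obtain ⟨f1, f2, f3⟩ := f.2
        refine ⟨fun l₁ l₂ u v => ?_, fun l₁ l₂ c u => ?_, fun l₁ l₂ i j u hu v hv => ?_⟩
        · simp only [f1, List.length_append, List.length_cons]; ring
        · simp only [f2, List.length_append, List.length_cons]; ring
        · simp only [f3 l₁ l₂ i j u hu v hv, List.length_append, List.length_cons]; ring⟩
      map_add' := fun f g => Subtype.ext (funext fun l => by simp [mul_add])
      map_smul' := fun c f => Subtype.ext (funext fun l => by simp; ring) }
  suffices h : ∑ i, mul (lin 𝒲 (B.x i)) (deriv 𝒲 (B.e i) f) = N f by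
    rw [h]; rfl
  refine form_ext_homog fun l hl => ?_
  change _ = (l.length : k) * f.1 l
  induction l generalizing f with
  | nil => simp [mul_nil, lin_nil]
  | cons w l ih =>
    obtain ⟨j, hj⟩ := hl w (by simp)
    have ih' := fun f => ih f fun u hu => hl u (by simp [hu])
    have key : deriv 𝒲 w (∑ i, mul (lin 𝒲 (B.x i)) (deriv 𝒲 (B.e i) f)) =
        deriv 𝒲 w f + ∑ i, mul (lin 𝒲 (B.x i)) (deriv 𝒲 (B.e i) (deriv 𝒲 w f)) := by
      rw [map_sum]
      conv_rhs => rw [B.deriv_eq w f, ← Finset.sum_add_distrib]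
      refine Finset.sum_congr rfl fun i _ => ?_
      -- When `∂_w` hits `x_i`, the terms sum to `∂_w f`. Otherwise it passes `x_i` and then `∂_i`,
      -- which have equal parity, and the two signs cancel.
      rw [deriv_mul hj, deriv_lin, const_mul, (B.lin_parity i).formTw,
        deriv_deriv (B.e_mem i) hj, mul_smul_left, mul_smul_right, smul_smul, mul_comm j,
        sgn_mul_self, one_smul, ← B.deriv_eq w f]
    rw [form_cons, key, Submodule.coe_add, Pi.add_apply, ih', form_cons, List.length_cons]
    push_cast
    ring

/-- The inverse of the Euler vector field on functions without constant term. -/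
def eulerInv (f : Form 𝒲) : Form 𝒲 :=
  ⟨fun l => (l.length : k)⁻¹ * f.1 l, by
    obtain ⟨f1, f2, f3⟩ := f.2
    refine ⟨fun l₁ l₂ u v => ?_, fun l₁ l₂ c u => ?_, fun l₁ l₂ i j u hu v hv => ?_⟩
    · simp only [f1, List.length_append, List.length_cons]; ring
    · simp only [f2, List.length_append, List.length_cons]; ring
    · simp only [f3 l₁ l₂ i j u hu v hv, List.length_append, List.length_cons]; ring⟩

/-- Hadamard's lemma: the Euler field applied to `eulerInv f` recovers `f` in positive degrees,
where the degree is invertible. In degree zero it gives zero, whence the separate constant term. -/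
theorem HomFrame.hadamard [CharZero k] (f : Form 𝒲) :
    f = const 𝒲 (f.1 []) + ∑ i, mul (lin 𝒲 (B.x i)) (deriv 𝒲 (B.e i) (eulerInv f)) := by
  refine Subtype.ext (funext fun l => ?_)
  rw [Submodule.coe_add, Pi.add_apply, B.euler]
  rcases l with _ | ⟨w, l⟩
  · simp [const]
  · have h : ((w :: l).length : k) ≠ 0 := by
      rw [List.length_cons]; exact_mod_cast Nat.succ_ne_zero l.length
    change _ = (if w :: l = [] then f.1 [] else 0) +
      ((w :: l).length : k) * (((w :: l).length : k)⁻¹ * f.1 (w :: l))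
    rw [mul_inv_cancel_left₀ h, if_neg (List.cons_ne_nil _ _), zero_add]

/-! ### Derivations -/

/-- Derivations of parity `p`, described without homogeneity assumptions. -/
structure IsDer (p : ZMod 2) (D : Form 𝒲 →ₗ[k] Form 𝒲) : Prop where
  formTw : ∀ i f, formTw 𝒲 i (D f) = sgn k (i * p) • D (formTw 𝒲 i f)
  leibniz : ∀ f g, D (mul f g) = mul (D f) g + mul (SuperLInfty.formTw 𝒲 p f) (D g)

/-- With signs written as twists, both conditions are linear in `f`, and every function is a sum of
an even and an odd one. -/
theorem isDerivation_iff [CharZero k] {p : ZMod 2} {D : Form 𝒲 →ₗ[k] Form 𝒲} :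
    IsDerivation p D ↔ IsDer p D := by
  constructor
  · intro h
    constructor
    · intro i
      suffices e : SuperLInfty.formTw 𝒲 i ∘ₗ D =
          sgn k (i * p) • D ∘ₗ SuperLInfty.formTw 𝒲 i from fun f => LinearMap.congr_fun e f
      refine form_hom_ext fun q f hf => ?_
      simp only [LinearMap.comp_apply, LinearMap.smul_apply]
      rw [(h.parity q f hf).formTw, hf.formTw, map_smul, smul_smul, mul_add, sgn_add, mul_comm]
    · intro f g
      suffices e : D ∘ₗ (mulL 𝒲).flip g =
          (mulL 𝒲).flip g ∘ₗ D + (mulL 𝒲).flip (D g) ∘ₗ SuperLInfty.formTw 𝒲 p from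
        LinearMap.congr_fun e f
      refine form_hom_ext fun q f hf => ?_
      simp only [LinearMap.comp_apply, LinearMap.add_apply, LinearMap.flip_apply, mulL_apply]
      rw [h.leibniz q f g hf, hf.formTw, mul_smul_left]
  · intro h
    constructor
    · intro q f hf
      rw [hasParity_iff, h.formTw, hf.formTw, map_smul, smul_smul, one_mul, one_mul, add_comm,
        sgn_add]
    · intro q f g hf
      rw [h.leibniz, hf.formTw, mul_smul_left]

theorem diff_isDer : IsDer 1 (diff 𝒲) where
  formTw i f := by rw [formTw_diff, mul_one]
  leibniz := diff_mul

theorem IsDer.hasParity [CharZero k] {p q : ZMod 2} {D : Form 𝒲 →ₗ[k] Form 𝒲} (h : IsDer p D)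
    {f : Form 𝒲} (hf : HasParity q f) : HasParity (q + p) (D f) :=
  (isDerivation_iff.mpr h).parity q f hf

theorem IsDer.map_const {p : ZMod 2} {D : Form 𝒲 →ₗ[k] Form 𝒲} (h : IsDer p D) (c : k) :
    D (const 𝒲 c) = 0 := by
  have e1 := h.leibniz (const 𝒲 1) (const 𝒲 1)
  rw [const_mul, formTw_const, const_mul, mul_const, one_smul, one_smul, left_eq_add] at e1
  have e2 : const 𝒲 c = c • const 𝒲 1 := by
    refine Subtype.ext (funext fun l => ?_)
    simp [const]
  rw [e2, map_smul, e1, smul_zero]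

theorem IsDer.add {p : ZMod 2} {D E : Form 𝒲 →ₗ[k] Form 𝒲} (hD : IsDer p D) (hE : IsDer p E) :
    IsDer p (D + E) where
  formTw i f := by
    simp only [LinearMap.add_apply, map_add, hD.formTw, hE.formTw, smul_add]
  leibniz f g := by
    simp only [LinearMap.add_apply, hD.leibniz, hE.leibniz, mul_add_left, mul_add_right]
    abel

theorem IsDer.smul {p : ZMod 2} {D : Form 𝒲 →ₗ[k] Form 𝒲} (c : k) (hD : IsDer p D) :
    IsDer p (c • D) where
  formTw i f := by
    simp only [LinearMap.smul_apply, map_smul, hD.formTw, smul_smul, mul_comm]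
  leibniz f g := by
    simp only [LinearMap.smul_apply, hD.leibniz, mul_smul_left, mul_smul_right, smul_add]

theorem IsDer.bracket_one_one {D E : Form 𝒲 →ₗ[k] Form 𝒲} (hD : IsDer 1 D) (hE : IsDer 1 E) :
    IsDer 0 (bracket 1 1 D E) where
  formTw i f := by
    simp only [bracket, LinearMap.add_apply, LinearMap.comp_apply, map_add, map_smul, hD.formTw, hE.formTw, mul_one, sgn_one, neg_neg, one_smul, smul_smul,
      sgn_mul_self, mul_zero, sgn_zero]
  leibniz f g := by
    simp only [bracket, LinearMap.add_apply, LinearMap.comp_apply, mul_one,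
      sgn_one, neg_neg, one_smul, hD.leibniz, hE.leibniz, map_add, mul_add_left, mul_add_right,
      hD.formTw, hE.formTw, formTw_formTw, zmod_two_one_add_one, formTw_zero,
      mul_smul_left]
    module

/-- By Hadamard's lemma `D f = ∑ ± x_i D(g_i)`, so if every value of `D` vanishes to order `n`,
every value vanishes to order `n + 1`. No continuity assumption on `D` is needed. -/
theorem HomFrame.eq_zero_of_map_lin [CharZero k] {p : ZMod 2} {D : Form 𝒲 →ₗ[k] Form 𝒲}
    (hD : IsDer p D) (h : ∀ i, D (lin 𝒲 (B.x i)) = 0) : D = 0 := by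
  have key : ∀ n f, AtLeast n (D f) := by
    intro n
    induction n with
    | zero => intro f l hl; simp at hl
    | succ n ih =>
      intro f
      rw [B.hadamard f, map_add, hD.map_const, zero_add, map_sum]
      refine AtLeast.sum _ fun i _ => ?_
      rw [hD.leibniz, h, mul_zero_left, zero_add, (B.lin_parity i).formTw, mul_smul_left]
      exact (lin_mul_atLeast _ _ n (ih _)).smul _
  exact LinearMap.ext fun f => Subtype.ext (funext fun l => key _ f l (Nat.lt_succ_self _))

theorem HomFrame.ext_of_map_lin [CharZero k] {p : ZMod 2} {D E : Form 𝒲 →ₗ[k] Form 𝒲}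
    (hD : IsDer p D) (hE : IsDer p E) (h : ∀ i, D (lin 𝒲 (B.x i)) = E (lin 𝒲 (B.x i))) :
    D = E := by
  have e := B.eq_zero_of_map_lin (hD.add (hE.smul (-1))) fun i => by simp [h]
  exact sub_eq_zero.mp (by rw [← e]; module)

/-- The vector field `∑ c_i ∂_i`. -/
def HomFrame.field (c : ι → Form 𝒲) : Form 𝒲 →ₗ[k] Form 𝒲 :=
  ∑ i, mulL 𝒲 (c i) ∘ₗ deriv 𝒲 (B.e i)

theorem HomFrame.field_apply (c : ι → Form 𝒲) (f : Form 𝒲) :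
    B.field c f = ∑ i, mul (c i) (deriv 𝒲 (B.e i) f) := by
  simp [HomFrame.field, mulL_apply]

theorem HomFrame.field_isDer [CharZero k] {p : ZMod 2} {c : ι → Form 𝒲}
    (hc : ∀ i, HasParity (B.p i + p) (c i)) : IsDer p (B.field c) where
  formTw j f := by
    simp only [HomFrame.field_apply, map_sum, Finset.smul_sum]
    refine Finset.sum_congr rfl fun i _ => ?_
    rw [formTw_mul, (hc i).formTw, formTw_deriv j (B.e_mem i), mul_smul_left, mul_smul_right,
      smul_smul, ← sgn_add]
    congr 2
    exact (by decide : ∀ j a p : ZMod 2, j * (a + p) + j * a = j * p) j (B.p i) p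
  leibniz f g := by
    simp only [HomFrame.field_apply, mul_sum_left, mul_sum_right, ← Finset.sum_add_distrib]
    refine Finset.sum_congr rfl fun i _ => ?_
    -- Moving `c_i`, of parity `p_i + p`, to the left of the `p`-twisted `f` leaves exactly the
    -- twist by `p_i` produced by `∂_i`.
    rw [deriv_mul (B.e_mem i), mul_add_right, ← mul_assoc, ← mul_assoc (SuperLInfty.formTw 𝒲 p f),
      mul_eq_mul_formTw (SuperLInfty.formTw 𝒲 p f) (hc i), formTw_formTw,
      (by decide : ∀ a p : ZMod 2, a + p + p = a) (B.p i) p, mul_assoc, mul_assoc]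

theorem HomFrame.field_lin (c : ι → Form 𝒲) (y : Module.Dual k W) :
    B.field c (lin 𝒲 y) = ∑ i, y (B.e i) • c i := by
  simp only [HomFrame.field_apply, deriv_lin, mul_const]

theorem map_lin_eq_sum (D : Form 𝒲 →ₗ[k] Form 𝒲) (y : Module.Dual k W) :
    D (lin 𝒲 y) = ∑ i, y (B.e i) • D (lin 𝒲 (B.x i)) := by
  conv_lhs => rw [B.dual_eq y]
  simp only [map_sum, map_smul]

theorem IsDer.eq_field [CharZero k] {p : ZMod 2} {D : Form 𝒲 →ₗ[k] Form 𝒲} (hD : IsDer p D) :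
    D = B.field fun i => D (lin 𝒲 (B.x i)) := by
  refine B.ext_of_map_lin hD (B.field_isDer fun i => hD.hasParity (B.lin_parity i)) fun i => ?_
  rw [B.field_lin, ← map_lin_eq_sum]

theorem IsDer.apply_eq_sum [CharZero k] {p : ZMod 2} {D : Form 𝒲 →ₗ[k] Form 𝒲} (hD : IsDer p D)
    (f : Form 𝒲) : D f = ∑ i, mul (D (lin 𝒲 (B.x i))) (deriv 𝒲 (B.e i) f) := by
  conv_lhs => rw [hD.eq_field B, B.field_apply]

/-- The divergence of an odd vector field in an arbitrary homogeneous frame. -/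
theorem HomFrame.divergence_eq [FiniteDimensional k W] (D : Form 𝒲 →ₗ[k] Form 𝒲) :
    divergence 1 D = ∑ i, deriv 𝒲 (B.e i) (D (lin 𝒲 (B.x i))) := by
  have h : divergence 1 D = ∑ a, deriv 𝒲 ((stdFrame 𝒲).e a) (D (lin 𝒲 ((stdFrame 𝒲).x a))) := by
    rw [divergence, Fintype.sum_sigma]
    refine Finset.sum_congr rfl fun i _ => Finset.sum_congr rfl fun j _ => ?_
    -- One of `i` and `1 + i` is zero, so the sign in the divergence of an odd field is trivial.
    rw [(by decide : ∀ i : ZMod 2, (1 + i) * i = 0) i, sgn_zero, one_smul]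
    rfl
  rw [h]
  -- As for the basis independence of a trace, expanding each frame in the other gives the same
  -- double sum.
  have e1 : ∀ a, deriv 𝒲 ((stdFrame 𝒲).e a) (D (lin 𝒲 ((stdFrame 𝒲).x a))) =
      ∑ i, B.x i ((stdFrame 𝒲).e a) • deriv 𝒲 (B.e i) (D (lin 𝒲 ((stdFrame 𝒲).x a))) :=
    fun a => B.deriv_eq _ _
  have e2 : ∀ i, deriv 𝒲 (B.e i) (D (lin 𝒲 (B.x i))) =
      ∑ a, B.x i ((stdFrame 𝒲).e a) • deriv 𝒲 (B.e i) (D (lin 𝒲 ((stdFrame 𝒲).x a))) := by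
    intro i
    rw [map_lin_eq_sum (stdFrame 𝒲) D (B.x i), map_sum]
    simp only [map_smul]
  simp only [e1, e2]
  exact Finset.sum_comm

theorem lin_apply_taylor [FiniteDimensional k W] (D : Form 𝒲 →ₗ[k] Form 𝒲) (l : List W)
    (y : Module.Dual k W) : y (taylor D l) = (D (lin 𝒲 y)).1 l := by
  rw [taylor, Module.apply_evalEquiv_symm_apply]
  rfl

end Forms

/-! ### Commutative dg algebras -/

section Algebra

variable {k A : Type*} [Field k] [Ring A] [Algebra k A] (𝒜 : CDGA k A)

theorem CDGA.tw_mul (i : ZMod 2) (a b : A) : 𝒜.tw i (a * b) = 𝒜.tw i a * 𝒜.tw i b := by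
  induction a using 𝒜.induction_homog with
  | hom p a ha =>
    induction b using 𝒜.induction_homog with
    | hom q b hb =>
      rw [𝒜.tw_of_mem i ha, 𝒜.tw_of_mem i hb, 𝒜.tw_of_mem i (𝒜.mul_mem p q a ha b hb),
        smul_mul_smul_comm, mul_add, sgn_add]
    | add u v hu hv => simp only [mul_add, map_add, hu, hv]
  | add u v hu hv => simp only [add_mul, map_add, hu, hv]

theorem CDGA.tw_unit (i : ZMod 2) : 𝒜.tw i (1 : A) = 1 := by
  rw [𝒜.tw_of_mem i 𝒜.one_mem, mul_zero, sgn_zero, one_smul]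

theorem CDGA.d_mul (a b : A) : 𝒜.d (a * b) = 𝒜.d a * b + 𝒜.tw 1 a * 𝒜.d b := by
  induction a using 𝒜.induction_homog with
  | hom p a ha => rw [𝒜.leibniz p a ha, 𝒜.tw_of_mem 1 ha, one_mul, smul_mul_assoc]
  | add u v hu hv => simp only [add_mul, map_add, hu, hv]; abel

theorem CDGA.mul_eq_tw_mul {i : ZMod 2} {a : A} (ha : a ∈ 𝒜.part i) (b : A) :
    a * b = 𝒜.tw i b * a := by
  induction b using 𝒜.induction_homog with
  | hom q b hb => rw [𝒜.mul_comm i q a ha b hb, 𝒜.tw_of_mem i hb, smul_mul_assoc]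
  | add u v hu hv => simp only [mul_add, add_mul, map_add, hu, hv]

theorem CDGA.d_unit : 𝒜.d (1 : A) = 0 := by
  have h := 𝒜.d_mul 1 1
  rw [𝒜.tw_unit, one_mul, mul_one, one_mul] at h
  exact left_eq_add.mp h

/-- Leibniz and commutativity give `de = 2e·de`; multiplying by `e` gives `e·de = 0`, hence `de =
0`. So `e ⊗ V` is stable under the differential. -/
theorem CDGA.d_idempotent {e : A} (he : e ∈ 𝒜.part 0) (hee : e * e = e) : 𝒜.d e = 0 := by
  have h := 𝒜.leibniz 0 e he e
  rw [hee, sgn_zero, one_smul] at h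
  have h1 : 𝒜.d e * e = e * 𝒜.d e := by
    simpa using 𝒜.mul_comm _ _ _ (𝒜.d_mem 0 e he) _ he
  have h2 : e * 𝒜.d e = e * 𝒜.d e + e * 𝒜.d e := by
    conv_lhs => rw [h, h1, mul_add, ← _root_.mul_assoc, hee]
  rw [h, h1]
  rw [left_eq_add.mp h2, add_zero]

/-- The operator `φ ↦ φ (a * (-1)^{β |·|} ·)` on the dual of `A`. -/
def CDGA.act (β : ZMod 2) : A →ₗ[k] Module.Dual k A →ₗ[k] Module.Dual k A :=
  LinearMap.mk₂ k (fun a φ => φ ∘ₗ LinearMap.mulLeft k a ∘ₗ 𝒜.tw β)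
    (fun a b φ => by ext; simp [add_mul]) (fun c a φ => by ext; simp)
    (fun a φ ψ => by ext; simp) (fun c a φ => by ext; simp)

theorem CDGA.act_apply (β : ZMod 2) (a : A) (φ : Module.Dual k A) (b : A) :
    𝒜.act β a φ b = φ (a * 𝒜.tw β b) := rfl

theorem CDGA.list_prod_mem {V : Type*} [AddCommGroup V] [Module k V] {𝒱 : DGSpace k V}
    {l : List (A × V)} {s : List (ZMod 2 × ZMod 2)}
    (h : List.Forall₂ (fun x p => x.1 ∈ 𝒜.part p.1 ∧ x.2 ∈ 𝒱.shift.part p.2) l s) :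
    (l.map Prod.fst).prod ∈ 𝒜.part (s.map Prod.fst).sum := by
  induction h with
  | nil => exact 𝒜.one_mem
  | cons hx _ ih => exact 𝒜.mul_mem _ _ _ hx.1 _ ih

end Algebra

/-! ### Functions on a tensor product -/

section Star

variable {k A V : Type*} [Field k] [Ring A] [Algebra k A] [AddCommGroup V]
  [Module k V] (𝒜 : CDGA k A) (𝒱 : DGSpace k V)

/-- The effect of contraction with a vector of `A ⊗ V` on the pair of a linear function on `A` and
a formal function on `ΠV`. -/
def contr : A ⊗[k] V →ₗ[k] Module.End k (Module.Dual k A ⊗[k] Form 𝒱.shift) :=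
  ∑ β : ZMod 2, TensorProduct.map₂ (𝒜.act β) (derivL 𝒱.shift ∘ₗ 𝒱.shift.proj β)

variable {𝒱} in
theorem contr_tmul (a : A) {β : ZMod 2} {v : V} (hv : v ∈ 𝒱.shift.part β)
    (φ : Module.Dual k A) (g : Form 𝒱.shift) :
    contr 𝒜 𝒱 (a ⊗ₜ v) (φ ⊗ₜ g) = 𝒜.act β a φ ⊗ₜ deriv 𝒱.shift v g := by
  have h : contr 𝒜 𝒱 (a ⊗ₜ v) (φ ⊗ₜ g) =
      ∑ i : ZMod 2, 𝒜.act i a φ ⊗ₜ[k] derivL 𝒱.shift (𝒱.shift.proj i v) g := by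
    simp [contr]
  rw [h, Fintype.sum_eq_single β fun i hi => ?_]
  · rw [𝒱.shift.proj_self hv, derivL_apply]
  · have e : β = i + 1 := (by decide : ∀ a b : ZMod 2, a ≠ b → b = a + 1) _ _ hi
    subst e
    rw [𝒱.shift.proj_other hv, map_zero, LinearMap.zero_apply, TensorProduct.tmul_zero]

variable [CharZero k]

/-- The dg space `Π(A ⊗ V)`. -/
abbrev tensorShift : DGSpace k (A ⊗[k] V) := (𝒜.toDGSpace.tensor 𝒱).shift

theorem tmul_mem_tensorShift {α β : ZMod 2} {a : A} {v : V} (ha : a ∈ 𝒜.part α)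
    (hv : v ∈ 𝒱.shift.part β) : a ⊗ₜ[k] v ∈ (tensorShift 𝒜 𝒱).part (α + β) := by
  have h := tmul_mem_tensorPart 𝒜.toDGSpace 𝒱 ha hv
  rw [← add_assoc] at h
  exact h

variable {𝒱} in
theorem mk_mem_tensorShift {e : A} (he : e ∈ 𝒜.part 0) (i : ZMod 2) (v : V) (hv : v ∈ 𝒱.shift.part i) :
    TensorProduct.mk k A V e v ∈ (tensorShift 𝒜 𝒱).part i := by
  simpa using tmul_mem_tensorShift 𝒜 𝒱 he hv

theorem tensorShift_induction {i : ZMod 2} {S : Submodule k (A ⊗[k] V)}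
    (h : ∀ α β, α + β = i → ∀ a ∈ 𝒜.part α, ∀ v ∈ 𝒱.shift.part β, a ⊗ₜ[k] v ∈ S) :
    (tensorShift 𝒜 𝒱).part i ≤ S := by
  refine tensorPart_induction 𝒜.toDGSpace 𝒱 fun α β hαβ a ha v hv => ?_
  refine h α (β + 1) (by rw [← add_assoc, hαβ, add_assoc, zmod_two_one_add_one, add_zero]) a ha v ?_
  change v ∈ 𝒱.part (β + 1 + 1)
  rwa [add_assoc, zmod_two_one_add_one, add_zero]

/-- Two functions on `Π(A ⊗ V)` agree if they agree on homogeneous pure tensors. -/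
theorem tensorForm_ext {f g : Form (tensorShift 𝒜 𝒱)}
    (h : ∀ (l : List (A × V)) (s : List (ZMod 2 × ZMod 2)),
      List.Forall₂ (fun x p => x.1 ∈ 𝒜.part p.1 ∧ x.2 ∈ 𝒱.shift.part p.2) l s →
      f.1 (l.map fun x => x.1 ⊗ₜ[k] x.2) = g.1 (l.map fun x => x.1 ⊗ₜ[k] x.2)) : f = g := by
  refine Subtype.ext (funext fun l => ?_)
  induction l generalizing f g with
  | nil => exact h [] [] .nil
  | cons w l ih =>
    have hom : ∀ α β, ∀ a ∈ 𝒜.part α, ∀ v ∈ 𝒱.shift.part β,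
        f.1 (a ⊗ₜ[k] v :: l) = g.1 (a ⊗ₜ[k] v :: l) := by
      intro α β a ha v hv
      exact ih (f := deriv _ (a ⊗ₜ v) f) (g := deriv _ (a ⊗ₜ v) g) fun l s hs =>
        h ((a, v) :: l) ((α, β) :: s) (.cons ⟨ha, hv⟩ hs)
    have add : ∀ (f : Form (tensorShift 𝒜 𝒱)) u v, f.1 ((u + v) :: l) = f.1 (u :: l) + f.1 (v :: l) :=
      fun f u v => f.2.1 [] l u v
    induction w using TensorProduct.induction_on with
    | zero => rw [form_cons, form_cons, ← derivL_apply, ← derivL_apply, map_zero]; rfl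
    | add u v hu hv => rw [add, add, hu, hv]
    | tmul a v =>
      induction a using 𝒜.induction_homog with
      | hom α a ha =>
        induction v using 𝒱.shift.induction_homog with
        | hom β v hv => exact hom α β a ha v hv
        | add u v hu hv => rw [TensorProduct.tmul_add, add, add, hu, hv]
      | add a b ha hb => rw [TensorProduct.add_tmul, add, add, ha, hb]

/-- This makes iterated contraction supersymmetric. Interchanging `a ⊗ v` and `a' ⊗ v'` costs the
signs of `a` with `a'`, `v` with `v'`, `v` with `a'` and `v'` with `a`, with total exponent `(α +
β)(α' + β')`. -/
theorem contr_comm {i j : ZMod 2} {u w : A ⊗[k] V} (hu : u ∈ (tensorShift 𝒜 𝒱).part i)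
    (hw : w ∈ (tensorShift 𝒜 𝒱).part j) (T : Module.Dual k A ⊗[k] Form 𝒱.shift) :
    contr 𝒜 𝒱 w (contr 𝒜 𝒱 u T) = sgn k (i * j) • contr 𝒜 𝒱 u (contr 𝒜 𝒱 w T) := by
  let P : (A ⊗[k] V) →ₗ[k] (A ⊗[k] V) →ₗ[k] Module.End k (Module.Dual k A ⊗[k] Form 𝒱.shift) :=
    (LinearMap.mul k _).compl₁₂ (contr 𝒜 𝒱) (contr 𝒜 𝒱)
  suffices h : P w u = sgn k (i * j) • P u w from LinearMap.congr_fun h T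
  have h1 : (tensorShift 𝒜 𝒱).part i ≤ LinearMap.eqLocus (P w) (sgn k (i * j) • P.flip w) := by
    refine tensorShift_induction 𝒜 𝒱 ?_
    rintro α β rfl a ha v hv
    have h2 : (tensorShift 𝒜 𝒱).part j ≤
        LinearMap.eqLocus (P.flip (a ⊗ₜ v)) (sgn k ((α + β) * j) • P (a ⊗ₜ v)) := by
      refine tensorShift_induction 𝒜 𝒱 ?_
      rintro α' β' rfl a' ha' v' hv'
      refine LinearMap.mem_eqLocus.mpr (TensorProduct.ext' fun φ g => ?_)
      change contr 𝒜 𝒱 (a' ⊗ₜ v') (contr 𝒜 𝒱 (a ⊗ₜ v) (φ ⊗ₜ g)) =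
        sgn k ((α + β) * (α' + β')) • contr 𝒜 𝒱 (a ⊗ₜ v) (contr 𝒜 𝒱 (a' ⊗ₜ v') (φ ⊗ₜ g))
      simp only [contr_tmul 𝒜 a hv, contr_tmul 𝒜 a' hv']
      have e : 𝒜.act β' a' (𝒜.act β a φ) =
          sgn k (β * α' + α * α' + β' * α) • 𝒜.act β a (𝒜.act β' a' φ) := by
        refine LinearMap.ext fun b => ?_
        simp only [LinearMap.smul_apply, 𝒜.act_apply, 𝒜.tw_mul, 𝒜.tw_of_mem β ha',
          𝒜.tw_of_mem β' ha, 𝒜.tw_tw, ← _root_.mul_assoc, mul_smul_comm, smul_mul_assoc,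
          map_smul, smul_smul, 𝒜.mul_comm α α' a ha a' ha', ← sgn_add, add_comm β' β]
        congr 2
        exact (by decide : ∀ α α' β β' : ZMod 2,
          β * α' + α * α' = β * α' + α * α' + β' * α + β' * α) α α' β β'
      rw [e, deriv_deriv hv hv', TensorProduct.smul_tmul_smul, ← sgn_add]
      congr 2
      exact (by decide : ∀ α α' β β' : ZMod 2,
        β * α' + α * α' + β' * α + β * β' = (α + β) * (α' + β')) α α' β β'
    exact h2 hw
  exact h1 hu

/-- Iterated contraction, followed by evaluation at the origin. -/
def starAux : List (A ⊗[k] V) → Module.Dual k A ⊗[k] Form 𝒱.shift →ₗ[k] k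
  | [] => TensorProduct.lift (LinearMap.mk₂ k (fun φ g => φ 1 * g.1 [])
      (fun φ ψ g => by simp [add_mul]) (fun c φ g => by simp [_root_.mul_assoc])
      (fun φ g h => by simp [mul_add]) (fun c φ g => by simp; ring))
  | w :: l => starAux l ∘ₗ contr 𝒜 𝒱 w

theorem starAux_mem (T : Module.Dual k A ⊗[k] Form 𝒱.shift) :
    (fun l => starAux 𝒜 𝒱 l T) ∈ Form (tensorShift 𝒜 𝒱) := by
  refine ⟨fun l₁ => ?_, fun l₁ => ?_, fun l₁ => ?_⟩
  · induction l₁ generalizing T with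
    | nil => intro l₂ u v; simp [starAux]
    | cons w l ih => intro l₂ u v; exact ih (contr 𝒜 𝒱 w T) l₂ u v
  · induction l₁ generalizing T with
    | nil => intro l₂ c u; simp [starAux]
    | cons w l ih => intro l₂ c u; exact ih (contr 𝒜 𝒱 w T) l₂ c u
  · induction l₁ generalizing T with
    | nil =>
      intro l₂ i j u hu v hv
      simp only [List.nil_append, starAux, LinearMap.comp_apply]
      rw [contr_comm 𝒜 𝒱 hu hv, map_smul, smul_eq_mul]
    | cons w l ih => intro l₂ i j u hu v hv; exact ih (contr 𝒜 𝒱 w T) l₂ i j u hu v hv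

/-- The function `(a_1 ⊗ v_1, …, a_n ⊗ v_n) ↦ ± φ (a_1 ⋯ a_n) g (v_1, …, v_n)`. -/
def star : Module.Dual k A →ₗ[k] Form 𝒱.shift →ₗ[k] Form (tensorShift 𝒜 𝒱) :=
  TensorProduct.curry
    { toFun := fun T => ⟨fun l => starAux 𝒜 𝒱 l T, starAux_mem 𝒜 𝒱 T⟩
      map_add' := fun S T => Subtype.ext (funext fun l => map_add (starAux 𝒜 𝒱 l) S T)
      map_smul' := fun c T => Subtype.ext (funext fun l => map_smul (starAux 𝒜 𝒱 l) c T) }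

variable {𝒱}

theorem star_nil (φ : Module.Dual k A) (g : Form 𝒱.shift) :
    (star 𝒜 𝒱 φ g).1 [] = φ 1 * g.1 [] := rfl

/-- The recursion behind all computations with `star`; the twist in `act` is the sign of moving `v`
past the `A`-factors of the remaining arguments. -/
theorem deriv_star (a : A) {β : ZMod 2} {v : V} (hv : v ∈ 𝒱.shift.part β)
    (φ : Module.Dual k A) (g : Form 𝒱.shift) :
    deriv (tensorShift 𝒜 𝒱) (a ⊗ₜ v) (star 𝒜 𝒱 φ g) =
      star 𝒜 𝒱 (𝒜.act β a φ) (deriv 𝒱.shift v g) := by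
  refine Subtype.ext (funext fun l => ?_)
  change starAux 𝒜 𝒱 l (contr 𝒜 𝒱 (a ⊗ₜ v) (φ ⊗ₜ g)) = _
  rw [contr_tmul 𝒜 a hv]
  rfl

/-- The additional parity `i` of the leading symbol is carried past every `a_r`. -/
theorem koszul_eq (i j : ZMod 2) (s : List (ZMod 2 × ZMod 2)) :
    koszul (i + j) s = i * (s.map Prod.fst).sum + koszul j s := by
  induction s generalizing j with
  | nil => simp [koszul]
  | cons p s ih =>
    simp only [koszul, List.map_cons, List.sum_cons]
    rw [add_assoc, ih]
    ring

theorem star_apply (φ : Module.Dual k A) (g : Form 𝒱.shift)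
    {l : List (A × V)} {s : List (ZMod 2 × ZMod 2)}
    (h : List.Forall₂ (fun x p => x.1 ∈ 𝒜.part p.1 ∧ x.2 ∈ 𝒱.shift.part p.2) l s) :
    (star 𝒜 𝒱 φ g).1 (l.map fun x => x.1 ⊗ₜ[k] x.2) =
      sgn k (koszul 0 s) * (φ (l.map Prod.fst).prod * g.1 (l.map Prod.snd)) := by
  induction h generalizing φ g with
  | nil => simp [star_nil, koszul]
  | @cons x p l s hx hs ih =>
    have e := koszul_eq p.2 0 s
    rw [List.map_cons, form_cons, deriv_star 𝒜 x.1 hx.2, ih, 𝒜.act_apply,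
      𝒜.tw_of_mem _ (𝒜.list_prod_mem hs), List.map_cons, List.prod_cons, List.map_cons]
    simp only [koszul, zero_mul, zero_add, mul_smul_comm, map_smul, smul_eq_mul]
    rw [add_zero] at e
    rw [e, sgn_add, form_cons]
    ring

theorem star_atLeast {n : ℕ} (φ : Module.Dual k A) {g : Form 𝒱.shift} (hg : AtLeast n g) :
    AtLeast n (star 𝒜 𝒱 φ g) := by
  intro l hl
  -- The formula for `star φ g` is available on pure tensors only. Truncation to arity below `n` is
  -- again a formal function, because the defining relations compare lists of equal length; it
  -- vanishes on pure tensors, hence everywhere.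
  let K : Form (tensorShift 𝒜 𝒱) := ⟨fun l => if l.length < n then (star 𝒜 𝒱 φ g).1 l else 0, by
    obtain ⟨f1, f2, f3⟩ := (star 𝒜 𝒱 φ g).2
    refine ⟨fun l₁ l₂ u v => ?_, fun l₁ l₂ c u => ?_, fun l₁ l₂ i j u hu v hv => ?_⟩
    · simp only [f1, List.length_append, List.length_cons]; split_ifs <;> simp
    · simp only [f2, List.length_append, List.length_cons]; split_ifs <;> simp
    · simp only [f3 l₁ l₂ i j u hu v hv, List.length_append, List.length_cons]
      split_ifs <;> simp⟩
  have h : K = 0 := by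
    refine tensorForm_ext 𝒜 𝒱 fun l s hs => ?_
    change (if _ then _ else _) = (0 : k)
    split_ifs with hl
    · rw [star_apply 𝒜 φ g hs, hg _ (by simpa using hl), mul_zero, mul_zero]
    · rfl
  have h' := congrArg (fun f : Form (tensorShift 𝒜 𝒱) => f.1 l) h
  simpa [K, hl] using h'

theorem formTw_star (i : ZMod 2) (φ : Module.Dual k A) (g : Form 𝒱.shift) :
    formTw (tensorShift 𝒜 𝒱) i (star 𝒜 𝒱 φ g) =
      star 𝒜 𝒱 (φ ∘ₗ 𝒜.tw i) (formTw 𝒱.shift i g) := by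
  refine tensorForm_ext 𝒜 𝒱 fun l s hs => ?_
  induction hs generalizing φ g with
  | nil => simp [formTw_nil, star_nil, 𝒜.tw_unit]
  | @cons x p l s hx hs ih =>
    have hw := tmul_mem_tensorShift 𝒜 𝒱 hx.1 hx.2
    have e : 𝒜.act p.2 x.1 (φ ∘ₗ 𝒜.tw i) = sgn k (i * p.1) • (𝒜.act p.2 x.1 φ) ∘ₗ 𝒜.tw i := by
      refine LinearMap.ext fun b => ?_
      simp only [𝒜.act_apply, LinearMap.comp_apply, LinearMap.smul_apply, 𝒜.tw_mul,
        𝒜.tw_of_mem i hx.1, 𝒜.tw_tw, smul_mul_assoc, map_smul, add_comm]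
    rw [List.map_cons, form_cons, form_cons, deriv_formTw i hw, deriv_star 𝒜 x.1 hx.2,
      deriv_star 𝒜 x.1 hx.2, deriv_formTw i hx.2, e]
    simp only [map_smul, LinearMap.smul_apply, Submodule.coe_smul, Pi.smul_apply]
    rw [ih, mul_add, sgn_add, smul_smul, _root_.mul_comm]

theorem lin_map_eq_star (φ : Module.Dual k A) (x : Module.Dual k V) (y : Module.Dual k (A ⊗[k] V))
    (h : ∀ a v, y (a ⊗ₜ v) = φ a * x v) :
    lin (tensorShift 𝒜 𝒱) y = star 𝒜 𝒱 φ (lin 𝒱.shift x) := by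
  refine tensorForm_ext 𝒜 𝒱 fun l s hs => ?_
  rw [star_apply 𝒜 φ _ hs]
  rcases hs with _ | ⟨_, _ | _⟩
  · simp [lin]
  · simp [lin, koszul, h]
  · simp [lin]

theorem tensorShift_d (a : A) {α : ZMod 2} (ha : a ∈ 𝒜.part α) (v : V) :
    (tensorShift 𝒜 𝒱).d (a ⊗ₜ v) = 𝒜.d a ⊗ₜ v + sgn k α • (a ⊗ₜ[k] 𝒱.shift.d v) :=
  tensorD_tmul 𝒜.toDGSpace 𝒱 ha v

/-- The differential falls on the `V`-factors or on the `A`-factors. In the first case the odd `d`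
passes elements of `A`, which accounts for the twist. -/
theorem diff_star (φ : Module.Dual k A) (g : Form 𝒱.shift) :
    diff (tensorShift 𝒜 𝒱) (star 𝒜 𝒱 φ g) =
      star 𝒜 𝒱 (φ ∘ₗ 𝒜.tw 1) (diff 𝒱.shift g) + star 𝒜 𝒱 (φ ∘ₗ 𝒜.d) g := by
  refine tensorForm_ext 𝒜 𝒱 fun l s hs => ?_
  induction hs generalizing φ g with
  | nil => simp [diff_nil, star_nil, 𝒜.d_unit]
  | @cons x p l s hx hs ih =>
    have hw := tmul_mem_tensorShift 𝒜 𝒱 hx.1 hx.2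
    have e1 : 𝒜.act p.2 x.1 (φ ∘ₗ 𝒜.tw 1) = sgn k p.1 • 𝒜.act (p.2 + 1) x.1 φ := by
      refine LinearMap.ext fun b => ?_
      simp only [𝒜.act_apply, LinearMap.comp_apply, LinearMap.smul_apply, 𝒜.tw_mul,
        𝒜.tw_of_mem 1 hx.1, 𝒜.tw_tw, smul_mul_assoc, map_smul, one_mul, add_comm]
    have e2 : 𝒜.act p.2 x.1 φ ∘ₗ 𝒜.tw 1 = 𝒜.act (p.2 + 1) x.1 φ := by
      refine LinearMap.ext fun b => ?_
      simp only [𝒜.act_apply, LinearMap.comp_apply, 𝒜.tw_tw]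
    have e3 : 𝒜.act p.2 x.1 (φ ∘ₗ 𝒜.d) =
        𝒜.act p.2 (𝒜.d x.1) φ + sgn k (p.1 + p.2) • 𝒜.act p.2 x.1 φ ∘ₗ 𝒜.d := by
      refine LinearMap.ext fun b => ?_
      simp only [𝒜.act_apply, LinearMap.comp_apply, LinearMap.smul_apply, LinearMap.add_apply,
        𝒜.d_mul, 𝒜.d_tw, 𝒜.tw_of_mem 1 hx.1, smul_mul_assoc, mul_smul_comm, map_smul, map_add,
        one_mul, smul_smul, sgn_add, _root_.mul_comm (sgn k p.1)]
    rw [List.map_cons, form_cons, form_cons, map_add, deriv_diff hw, tensorShift_d 𝒜 x.1 hx.1,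
      deriv_add, deriv_smul, deriv_star 𝒜 x.1 hx.2, deriv_star 𝒜 x.1 (𝒱.shift.d_mem _ _ hx.2),
      deriv_star 𝒜 (𝒜.d x.1) hx.2, deriv_star 𝒜 x.1 hx.2, deriv_star 𝒜 x.1 hx.2,
      deriv_diff hx.2, e1, e3]
    simp only [map_smul, map_add, LinearMap.smul_apply, LinearMap.add_apply, Submodule.coe_smul,
      Submodule.coe_add, Pi.smul_apply, Pi.add_apply, smul_eq_mul, ih, e2, sgn_add]
    ring

end Star

/-! ### Tensor product frames, the supertrace functional and the induced vector field -/

section Frames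

variable {k A V : Type*} [Field k] [Ring A] [Algebra k A] [AddCommGroup V] [Module k V]
  {𝒜 : CDGA k A} {𝒱 : DGSpace k V} {ι κ : Type*} [Fintype ι] [Fintype κ]

theorem HomFrame.trace_eq {W : Type*} [AddCommGroup W] [Module k W] [FiniteDimensional k W]
    {𝒲 : DGSpace k W} (B : HomFrame 𝒲 ι) (T : W →ₗ[k] W) :
    LinearMap.trace k W T = ∑ i, B.x i (T (B.e i)) := by
  have h : T = ∑ i, dualTensorHom k W W (B.x i ⊗ₜ T (B.e i)) := by
    refine LinearMap.ext fun w => ?_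
    conv_lhs => rw [← B.sum_eq w]
    simp
  conv_lhs => rw [h]
  simp [map_sum]

theorem HomFrame.x_comp_tw (B : HomFrame 𝒜.toDGSpace ι) (j : ZMod 2) (i : ι) : B.x i ∘ₗ 𝒜.tw j = sgn k (j * B.p i) • B.x i :=
  LinearMap.ext fun w => B.x_tw i j w

/-- The supertrace of multiplication operators, as a linear function on `A`. -/
def CDGA.mulTrace (𝒜 : CDGA k A) : Module.Dual k A :=
  LinearMap.trace k A ∘ₗ LinearMap.lcomp k A 𝒜.invol ∘ₗ LinearMap.mul k A

theorem CDGA.mulTrace_apply (𝒜 : CDGA k A) (a : A) :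
    𝒜.mulTrace a = 𝒜.supertrace (LinearMap.mulLeft k a) := rfl

theorem CDGA.unimodular_iff (𝒜 : CDGA k A) : 𝒜.Unimodular ↔ 𝒜.mulTrace = 0 :=
  ⟨fun h => LinearMap.ext h, fun h a => LinearMap.congr_fun h a⟩

theorem HomFrame.mulTrace_eq [FiniteDimensional k A] (B : HomFrame 𝒜.toDGSpace ι) (a : A) :
    𝒜.mulTrace a = ∑ i, sgn k (B.p i) * B.x i (a * B.e i) := by
  rw [𝒜.mulTrace_apply, DGSpace.supertrace, B.trace_eq]
  refine Finset.sum_congr rfl fun i _ => ?_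
  simp [𝒜.invol_of_mem (B.e_mem i)]

theorem HomFrame.x_mul_eq_zero (B : HomFrame 𝒜.toDGSpace ι) (i : ι) {a b : A} {j : ZMod 2}
    (ha : a ∈ 𝒜.part (B.p i + j)) (hb : b ∈ 𝒜.part (j + 1)) : B.x i (a * b) = 0 := by
  refine B.x_eq_zero i _ ?_
  have h := 𝒜.mul_mem _ _ a ha b hb
  rwa [(by decide : ∀ p j : ZMod 2, p + j + (j + 1) = p + 1)] at h

theorem CDGA.mulTrace_odd [FiniteDimensional k A] (𝒜 : CDGA k A) {a : A} (ha : a ∈ 𝒜.part 1) :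
    𝒜.mulTrace a = 0 := by
  rw [(stdFrame 𝒜.toDGSpace).mulTrace_eq]
  refine Finset.sum_eq_zero fun i _ => ?_
  have h := 𝒜.mul_mem _ _ a ha _ ((stdFrame 𝒜.toDGSpace).e_mem i)
  rw [add_comm] at h
  rw [(stdFrame 𝒜.toDGSpace).x_eq_zero i _ h, mul_zero]

theorem CDGA.mulTrace_comp_tw [FiniteDimensional k A] (𝒜 : CDGA k A) (i : ZMod 2) :
    𝒜.mulTrace ∘ₗ 𝒜.tw i = 𝒜.mulTrace := by
  refine 𝒜.hom_ext fun j a ha => ?_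
  rw [LinearMap.comp_apply, 𝒜.tw_of_mem i ha, map_smul]
  rcases zmod_two_cases j with rfl | rfl
  · rw [mul_zero, sgn_zero, one_smul]
  · rw [𝒜.mulTrace_odd ha, smul_zero]

/-- For odd `a`, multiplication by `da` is the supercommutator of `d` with multiplication by `a`,
and supercommutators have supertrace zero. For even `a`, the element `da` is odd. -/
theorem CDGA.mulTrace_d [FiniteDimensional k A] (𝒜 : CDGA k A) : 𝒜.mulTrace ∘ₗ 𝒜.d = 0 := by
  refine 𝒜.hom_ext fun j a ha => ?_
  rw [LinearMap.comp_apply, LinearMap.zero_apply]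
  rcases zmod_two_cases j with rfl | rfl
  · exact 𝒜.mulTrace_odd (by simpa using 𝒜.d_mem 0 a ha)
  · have h1 : LinearMap.mulLeft k (𝒜.d a) =
        𝒜.d ∘ₗ LinearMap.mulLeft k a + LinearMap.mulLeft k a ∘ₗ 𝒜.d := by
      refine LinearMap.ext fun b => ?_
      simp [𝒜.leibniz 1 a ha]
    have h2 : 𝒜.d ∘ₗ 𝒜.invol = -(𝒜.invol ∘ₗ 𝒜.d) := by
      refine LinearMap.ext fun b => ?_
      rw [← 𝒜.tw_one]
      simp [𝒜.d_tw]
    rw [𝒜.mulTrace_apply, DGSpace.supertrace, h1, LinearMap.add_comp, map_add,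
      LinearMap.comp_assoc 𝒜.invol 𝒜.d, h2, LinearMap.comp_neg, map_neg, LinearMap.comp_assoc,
      LinearMap.trace_comp_comm', LinearMap.comp_assoc, add_neg_cancel]

variable [CharZero k]

/-- The tensor product of a frame of `A` and a frame of `ΠV`. -/
def HomFrame.tensor (B : HomFrame 𝒜.toDGSpace ι) (C : HomFrame 𝒱.shift κ) :
    HomFrame (tensorShift 𝒜 𝒱) (ι × κ) where
  p a := B.p a.1 + C.p a.2
  e a := B.e a.1 ⊗ₜ C.e a.2
  x a := LinearMap.mul' k k ∘ₗ TensorProduct.map (B.x a.1) (C.x a.2)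
  e_mem a := tmul_mem_tensorShift 𝒜 𝒱 (B.e_mem a.1) (C.e_mem a.2)
  x_eq_zero a w hw := by
    refine tensorShift_induction 𝒜 𝒱 (S := LinearMap.ker (LinearMap.mul' k k ∘ₗ
      TensorProduct.map (B.x a.1) (C.x a.2))) (fun α β h u hu v hv => ?_) hw
    simp only [LinearMap.mem_ker, LinearMap.comp_apply, TensorProduct.map_tmul,
      LinearMap.mul'_apply]
    by_contra hne
    rw [← B.parity_eq a.1 hu (left_ne_zero_of_mul hne),
      ← C.parity_eq a.2 hv (right_ne_zero_of_mul hne)] at h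
    simp at h
  sum_eq w := by
    induction w using TensorProduct.induction_on with
    | zero => simp
    | tmul u v =>
      conv_rhs => rw [← B.sum_eq u, ← C.sum_eq v]
      simp only [TensorProduct.sum_tmul, TensorProduct.tmul_sum, Fintype.sum_prod_type,
        LinearMap.comp_apply, TensorProduct.map_tmul, LinearMap.mul'_apply,
        TensorProduct.smul_tmul_smul]
      exact Finset.sum_comm
    | add u v hu hv => simp only [map_add, add_smul, Finset.sum_add_distrib, hu, hv]

theorem HomFrame.lin_tensor (B : HomFrame 𝒜.toDGSpace ι) (C : HomFrame 𝒱.shift κ) (a : ι × κ) :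
    lin (tensorShift 𝒜 𝒱) ((B.tensor C).x a) =
      star 𝒜 𝒱 (B.x a.1) (lin 𝒱.shift (C.x a.2)) :=
  lin_map_eq_star 𝒜 _ _ _ fun _ _ => rfl

/-- In the canonical element `∑ x_i ⊗ e_i` of `A^* ⊗ A`, an operator on one factor can be transposed
to the other. -/
theorem HomFrame.sum_star_comp_mul_star (B : HomFrame 𝒜.toDGSpace ι) (T : A →ₗ[k] A)
    (Ψ : A →ₗ[k] Module.Dual k A) (g h : Form 𝒱.shift) :
    ∑ i, mul (star 𝒜 𝒱 (B.x i ∘ₗ T) g) (star 𝒜 𝒱 (Ψ (B.e i)) h) =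
      ∑ i, mul (star 𝒜 𝒱 (B.x i) g) (star 𝒜 𝒱 (Ψ (T (B.e i))) h) := by
  have e1 : ∀ i, B.x i ∘ₗ T = ∑ j, B.x i (T (B.e j)) • B.x j := fun i => B.dual_eq (B.x i ∘ₗ T)
  have e2 : ∀ j, Ψ (T (B.e j)) = ∑ i, B.x i (T (B.e j)) • Ψ (B.e i) := by
    intro j
    conv_lhs => rw [← B.sum_eq (T (B.e j))]
    simp only [map_sum, map_smul]
  simp only [e1, e2, map_sum, map_smul, LinearMap.sum_apply, LinearMap.smul_apply, mul_sum_left,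
    mul_sum_right, mul_smul_left, mul_smul_right]
  exact Finset.sum_comm

/-- From `φ(ab) = ∑ x_i(a) φ(e_i b)`, the coproduct on `A^*` dual to multiplication. The twist by
`q` is the sign of moving `g` past the `A`-factors that go with `h`. -/
theorem HomFrame.star_mul (B : HomFrame 𝒜.toDGSpace ι) (φ : Module.Dual k A) {q : ZMod 2}
    {g : Form 𝒱.shift} (hg : HasParity q g) (h : Form 𝒱.shift) :
    star 𝒜 𝒱 φ (mul g h) =
      ∑ i, mul (star 𝒜 𝒱 (B.x i) g) (star 𝒜 𝒱 (𝒜.act q (B.e i) φ) h) := by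
  refine tensorForm_ext 𝒜 𝒱 fun l s hs => ?_
  induction hs generalizing φ q g h with
  | nil =>
    have e : φ 1 = ∑ i, B.x i 1 * φ (B.e i) := by
      conv_lhs => rw [← B.sum_eq 1]
      simp only [map_sum, map_smul, smul_eq_mul]
    simp only [List.map_nil, Submodule.coe_sum, Finset.sum_apply, mul_nil, star_nil, 𝒜.act_apply,
      𝒜.tw_unit, mul_one, e, Finset.sum_mul]
    exact Finset.sum_congr rfl fun i _ => by ring
  | @cons x p l s hx hs ih =>
    obtain ⟨a, v⟩ := x
    obtain ⟨α, β⟩ := p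
    obtain ⟨ha, hv⟩ := hx
    have hw := tmul_mem_tensorShift 𝒜 𝒱 ha hv
    -- `e1` and `e2` treat the terms in which the derivative along `a ⊗ v` falls on the first and on
    -- the second factor. Transposing operators in `∑ x_i ⊗ e_i` lets `a` act on `φ` alone, as the
    -- induction hypothesis requires.
    have e1 : ∑ i, mul (star 𝒜 𝒱 (𝒜.act β a (B.x i)) (deriv 𝒱.shift v g))
        (star 𝒜 𝒱 (𝒜.act q (B.e i) φ) h) =
        ∑ i, mul (star 𝒜 𝒱 (B.x i) (deriv 𝒱.shift v g))
          (star 𝒜 𝒱 (𝒜.act (q + β) (B.e i) (𝒜.act β a φ)) h) := by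
      have key : ∀ i, 𝒜.act q (a * 𝒜.tw β (B.e i)) φ =
          𝒜.act (q + β) (B.e i) (𝒜.act β a φ) := fun i => LinearMap.ext fun b => by
        simp only [𝒜.act_apply, 𝒜.tw_mul, 𝒜.tw_tw, _root_.mul_assoc,
          (by decide : ∀ a b : ZMod 2, b + (a + b) = a) q β]
      simp only [← key]
      exact B.sum_star_comp_mul_star (LinearMap.mulLeft k a ∘ₗ 𝒜.tw β) ((𝒜.act q).flip φ) _ _
    have e2 : ∑ i, mul (formTw (tensorShift 𝒜 𝒱) (α + β) (star 𝒜 𝒱 (B.x i) g))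
        (star 𝒜 𝒱 (𝒜.act β a (𝒜.act q (B.e i) φ)) (deriv 𝒱.shift v h)) =
        sgn k (β * q) • ∑ i, mul (star 𝒜 𝒱 (B.x i) g)
          (star 𝒜 𝒱 (𝒜.act q (B.e i) (𝒜.act β a φ)) (deriv 𝒱.shift v h)) := by
      have key : ∀ i, sgn k ((α + β) * q) • 𝒜.act β a (𝒜.act q (𝒜.tw (α + β) (B.e i)) φ) =
          sgn k (β * q) • 𝒜.act q (B.e i) (𝒜.act β a φ) := fun i => LinearMap.ext fun b => by
        simp only [𝒜.act_apply, LinearMap.smul_apply, 𝒜.tw_mul, 𝒜.tw_tw, 𝒜.tw_of_mem q ha,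
          mul_smul_comm, map_smul, smul_smul, ← _root_.mul_assoc, 𝒜.mul_eq_tw_mul ha, ← sgn_add,
          (by decide : ∀ α β q : ZMod 2, q + (α + β) = α + (β + q)) α β q]
        congr 2
        exact (by decide : ∀ α β q : ZMod 2, (α + β) * q + q * α = β * q) α β q
      have key' := B.sum_star_comp_mul_star (𝒜.tw (α + β)) (𝒜.act β a ∘ₗ (𝒜.act q).flip φ) g
        (deriv 𝒱.shift v h)
      simp only [LinearMap.comp_apply, LinearMap.flip_apply] at key'
      simp only [formTw_star, hg.formTw, map_smul, mul_smul_left, ← Finset.smul_sum]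
      rw [key', Finset.smul_sum, Finset.smul_sum]
      refine Finset.sum_congr rfl fun i _ => ?_
      have h' := congrArg (fun ψ => mul (star 𝒜 𝒱 (B.x i) g) (star 𝒜 𝒱 ψ (deriv 𝒱.shift v h)))
        (key i)
      simpa only [map_smul, LinearMap.smul_apply, mul_smul_right] using h'
    simp only [List.map_cons, form_cons, map_sum, deriv_mul hw, deriv_star 𝒜 a hv, deriv_mul hv,
      Finset.sum_add_distrib, map_add, hg.formTw, mul_smul_left, map_smul]
    rw [e1, e2]
    simp only [Submodule.coe_add, Submodule.coe_smul, Pi.add_apply, Pi.smul_apply]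
    rw [ih _ (hg.deriv hv), ih _ hg]

/-- The vector field on `Π(A ⊗ V)` induced by a vector field on `ΠV`. -/
def HomFrame.tensorField (B : HomFrame 𝒜.toDGSpace ι) (C : HomFrame 𝒱.shift κ)
    (m : Form 𝒱.shift →ₗ[k] Form 𝒱.shift) :
    Form (tensorShift 𝒜 𝒱) →ₗ[k] Form (tensorShift 𝒜 𝒱) :=
  (B.tensor C).field fun a => star 𝒜 𝒱 (B.x a.1 ∘ₗ 𝒜.tw 1) (m (lin 𝒱.shift (C.x a.2)))

variable (B : HomFrame 𝒜.toDGSpace ι) (C : HomFrame 𝒱.shift κ)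
  {m : Form 𝒱.shift →ₗ[k] Form 𝒱.shift}

theorem HomFrame.tensorField_isDer (hm : IsDer 1 m) : IsDer 1 (B.tensorField C m) := by
  refine (B.tensor C).field_isDer fun a => ?_
  rw [hasParity_iff, formTw_star, (hm.hasParity (C.lin_parity a.2)).formTw, B.x_comp_tw,
    LinearMap.smul_comp, B.x_comp_tw]
  simp only [map_smul, LinearMap.smul_apply, smul_smul, ← sgn_add, HomFrame.tensor]
  congr 2
  exact (by decide : ∀ a b : ZMod 2, 1 * (b + 1) + (1 * a + 1 * a) = a + b + 1 + 1 * a) _ _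

/-- Expand `m g = ∑ m(y_i) ∂_i g` and split each summand by `star_mul`; the twist in the
coefficients of the field is the sign of moving the odd `m` past elements of `A`. -/
theorem HomFrame.tensorField_star (hm : IsDer 1 m) (φ : Module.Dual k A) (g : Form 𝒱.shift) :
    B.tensorField C m (star 𝒜 𝒱 φ g) = star 𝒜 𝒱 (φ ∘ₗ 𝒜.tw 1) (m g) := by
  rw [HomFrame.tensorField, HomFrame.field_apply, hm.apply_eq_sum C g, map_sum,
    Fintype.sum_prod_type, Finset.sum_comm]
  refine Finset.sum_congr rfl fun i _ => ?_
  rw [B.star_mul _ (hm.hasParity (C.lin_parity i))]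
  refine Finset.sum_congr rfl fun j _ => ?_
  simp only [HomFrame.tensor]
  rw [deriv_star 𝒜 _ (C.e_mem i), B.x_comp_tw, map_smul, LinearMap.smul_apply, mul_smul_left,
    ← mul_smul_right, ← LinearMap.smul_apply, ← map_smul]
  congr 3
  refine LinearMap.ext fun b => ?_
  simp only [LinearMap.smul_apply, LinearMap.comp_apply, 𝒜.act_apply, 𝒜.tw_mul, 𝒜.tw_tw,
    𝒜.tw_of_mem 1 (B.e_mem j), smul_mul_assoc, map_smul,
    (by decide : ∀ a : ZMod 2, 1 + (a + 1) = a)]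

theorem HomFrame.divergence_tensorField [FiniteDimensional k A] [FiniteDimensional k V]
    (hm : IsDer 1 m) : divergence 1 (B.tensorField C m) = star 𝒜 𝒱 𝒜.mulTrace (divergence 1 m) := by
  rw [(B.tensor C).divergence_eq, C.divergence_eq, map_sum, Fintype.sum_prod_type,
    Finset.sum_comm]
  refine Finset.sum_congr rfl fun i _ => ?_
  have h : ∀ j, B.tensorField C m (lin (tensorShift 𝒜 𝒱) ((B.tensor C).x (j, i))) =
      star 𝒜 𝒱 (B.x j ∘ₗ 𝒜.tw 1) (m (lin 𝒱.shift (C.x i))) := fun j => by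
    rw [B.lin_tensor, B.tensorField_star C hm]
  simp only [h]
  -- The twist contributes `(-1)^{|e_j|}`, which makes the sum of the diagonal entries a supertrace.
  -- On odd `b` both sides vanish, so the remaining signs do not matter.
  have e : 𝒜.mulTrace = ∑ j, 𝒜.act (C.p i) (B.e j) (B.x j ∘ₗ 𝒜.tw 1) := by
    refine 𝒜.hom_ext fun r b hb => ?_
    rw [B.mulTrace_eq, LinearMap.sum_apply]
    refine Finset.sum_congr rfl fun j _ => ?_
    rw [𝒜.act_apply, B.x_comp_tw, LinearMap.smul_apply, smul_eq_mul, one_mul, 𝒜.tw_of_mem _ hb,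
      𝒜.mul_eq_tw_mul hb, 𝒜.tw_of_mem _ (B.e_mem j)]
    rcases zmod_two_cases r with rfl | rfl
    · simp
    · have h0 : B.x j (B.e j * b) = 0 :=
        B.x_mul_eq_zero (j := 0) j (by simpa using B.e_mem j) (by simpa using hb)
      simp [h0]
  rw [e, map_sum, LinearMap.sum_apply]
  exact Finset.sum_congr rfl fun j _ => deriv_star 𝒜 _ (C.e_mem i) _ _

end Frames

/-! ### Pullback along even linear maps -/

section Pullback

variable {k W W' : Type*} [Field k] [AddCommGroup W] [Module k W] [AddCommGroup W'] [Module k W']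
  {𝒲 : DGSpace k W} {𝒲' : DGSpace k W'}

/-- The pullback of formal functions along a linear map that preserves parity. -/
def pullback (T : W →ₗ[k] W') (hT : ∀ i, ∀ w ∈ 𝒲.part i, T w ∈ 𝒲'.part i) :
    Form 𝒲' →ₗ[k] Form 𝒲 where
  toFun f := ⟨fun l => f.1 (l.map T), by
    obtain ⟨f1, f2, f3⟩ := f.2
    refine ⟨fun l₁ l₂ u v => ?_, fun l₁ l₂ c u => ?_, fun l₁ l₂ i j u hu v hv => ?_⟩
    · simp only [List.map_append, List.map_cons, map_add, f1]
    · simp only [List.map_append, List.map_cons, map_smul, f2]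
    · simp only [List.map_append, List.map_cons]
      exact f3 _ _ i j _ (hT i u hu) _ (hT j v hv)⟩
  map_add' _ _ := rfl
  map_smul' _ _ := rfl

variable {T : W →ₗ[k] W'} {hT : ∀ i, ∀ w ∈ 𝒲.part i, T w ∈ 𝒲'.part i}

theorem pullback_apply (f : Form 𝒲') (l : List W) :
    (pullback T hT f).1 l = f.1 (l.map T) := rfl

theorem deriv_pullback (w : W) (f : Form 𝒲') :
    deriv 𝒲 w (pullback T hT f) = pullback T hT (deriv 𝒲' (T w) f) := rfl

theorem formTw_pullback (i : ZMod 2) (f : Form 𝒲') :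
    formTw 𝒲 i (pullback T hT f) = pullback T hT (formTw 𝒲' i f) := by
  refine Subtype.ext (funext fun l => ?_)
  have h : T ∘ 𝒲.tw i = 𝒲'.tw i ∘ T := by
    refine congrArg DFunLike.coe (𝒲.hom_ext (f := T ∘ₗ 𝒲.tw i) (g := 𝒲'.tw i ∘ₗ T)
      fun j w hw => ?_)
    simp only [LinearMap.comp_apply]
    rw [𝒲.tw_of_mem i hw, 𝒲'.tw_of_mem i (hT j w hw), map_smul]
  simp only [pullback_apply, formTw_apply, List.map_map, h]

theorem HasParity.pullback {q : ZMod 2} {f : Form 𝒲'} (hf : HasParity q f) :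
    HasParity q (pullback T hT f) := by
  intro l s hs hq
  refine hf (l.map T) s ?_ hq
  rw [List.forall₂_map_left_iff]
  exact hs.imp fun w i hw => hT i w hw

theorem pullback_mul (f g : Form 𝒲') :
    pullback T hT (mul f g) = mul (pullback T hT f) (pullback T hT g) := by
  refine form_ext_homog fun l hl => ?_
  induction l generalizing f g with
  | nil => rfl
  | cons w l ih =>
    obtain ⟨j, hj⟩ := hl w (by simp)
    have ih' := fun f g => ih f g fun u hu => hl u (by simp [hu])
    simp only [form_cons, deriv_pullback, deriv_mul hj, deriv_mul (hT j w hj), map_add,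
      Submodule.coe_add, Pi.add_apply, ih', formTw_pullback]

theorem pullback_diff (hd : ∀ w, T (𝒲.d w) = 𝒲'.d (T w)) (f : Form 𝒲') :
    pullback T hT (diff 𝒲' f) = diff 𝒲 (pullback T hT f) := by
  refine form_ext_homog fun l hl => ?_
  induction l generalizing f with
  | nil => rfl
  | cons w l ih =>
    obtain ⟨j, hj⟩ := hl w (by simp)
    have ih' := fun f => ih f fun u hu => hl u (by simp [hu])
    simp only [form_cons, deriv_pullback, deriv_diff hj, deriv_diff (hT j w hj), map_add,
      map_smul, Submodule.coe_add, Submodule.coe_smul, Pi.add_apply, Pi.smul_apply, ih', hd]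

end Pullback

/-! ### The tensor product of a cdga and an `L_∞` algebra -/

section LInfty

variable {k V : Type*} [Field k] [AddCommGroup V] [Module k V]

theorem LInfty.divergence_atLeast [FiniteDimensional k V] {𝒱 : DGSpace k V} (L : LInfty 𝒱) :
    AtLeast 1 (divergence 1 L.m) := by
  rw [(stdFrame 𝒱.shift).divergence_eq]
  exact AtLeast.sum _ fun i _ => (L.atLeast _).deriv _

variable [CharZero k]

theorem LInfty.isDer {𝒱 : DGSpace k V} (L : LInfty 𝒱) : IsDer 1 L.m :=
  isDerivation_iff.mp L.isDerivation

theorem LInfty.maurerCartan_apply {𝒱 : DGSpace k V} (L : LInfty 𝒱) (f : Form 𝒱.shift) :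
    diff 𝒱.shift (L.m f) + L.m (diff 𝒱.shift f) + L.m (L.m f) = 0 := by
  have h := LinearMap.congr_fun L.maurerCartan f
  simp only [bracket, mul_one, sgn_one, neg_neg, one_smul, LinearMap.add_apply,
    LinearMap.comp_apply, LinearMap.smul_apply, LinearMap.zero_apply] at h
  rw [← h]
  module

end LInfty

section Tensor

variable {k A V : Type*} [Field k] [CharZero k] [Ring A] [Algebra k A] [FiniteDimensional k A]
  [AddCommGroup V] [Module k V] [FiniteDimensional k V]

theorem LInfty.strictlyUnimodular_iff {𝒱 : DGSpace k V} (L : LInfty 𝒱) :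
    L.StrictlyUnimodular ↔ divergence 1 L.m = 0 := by
  have h0 : HasParity 0 (0 : Form 𝒱.shift) := fun l s _ _ => rfl
  have h2 : (1 / 2 : k) ≠ 0 := by norm_num
  simp only [LInfty.StrictlyUnimodular, LInfty.IsUnimodularWith, h0, true_and, map_zero, zero_add,
    add_zero, smul_eq_zero, h2, false_or]

variable (𝒜 : CDGA k A) {𝒱 : DGSpace k V} (L : LInfty 𝒱)

/-- The vector field of the `L_∞` structure on `A ⊗ V`. -/
def tensorM : Form (tensorShift 𝒜 𝒱) →ₗ[k] Form (tensorShift 𝒜 𝒱) :=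
  (stdFrame 𝒜.toDGSpace).tensorField (stdFrame 𝒱.shift) L.m

theorem tensorM_isDer : IsDer 1 (tensorM 𝒜 L) :=
  HomFrame.tensorField_isDer _ _ L.isDer

theorem tensorM_star (φ : Module.Dual k A) (g : Form 𝒱.shift) :
    tensorM 𝒜 L (star 𝒜 𝒱 φ g) = star 𝒜 𝒱 (φ ∘ₗ 𝒜.tw 1) (L.m g) :=
  HomFrame.tensorField_star _ _ L.isDer φ g

/-- The `L_∞` structure on `A ⊗ V`. -/
def tensorLInfty : LInfty (𝒜.toDGSpace.tensor 𝒱) where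
  m := tensorM 𝒜 L
  isDerivation := isDerivation_iff.mpr (tensorM_isDer 𝒜 L)
  atLeast y := by
    rw [tensorM, HomFrame.tensorField, HomFrame.field_lin]
    exact AtLeast.sum _ fun i _ => (star_atLeast 𝒜 _ (L.atLeast _)).smul _
  maurerCartan := by
    -- The left side is an even derivation, so it may be tested on coordinates, which have the form
    -- `star φ g`.
    refine ((stdFrame 𝒜.toDGSpace).tensor (stdFrame 𝒱.shift)).eq_zero_of_map_lin
      ((diff_isDer.bracket_one_one (tensorM_isDer 𝒜 L)).add
        (((tensorM_isDer 𝒜 L).bracket_one_one (tensorM_isDer 𝒜 L)).smul _)) fun i => ?_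
    rw [HomFrame.lin_tensor]
    generalize (stdFrame 𝒜.toDGSpace).x i.1 = φ
    generalize lin 𝒱.shift ((stdFrame 𝒱.shift).x i.2) = g
    have h := congrArg (star 𝒜 𝒱 φ) (L.maurerCartan_apply g)
    have e1 : (φ ∘ₗ 𝒜.tw 1) ∘ₗ 𝒜.tw 1 = φ := LinearMap.ext fun b => by
      simp only [LinearMap.comp_apply, 𝒜.tw_tw, zmod_two_one_add_one, 𝒜.tw_zero,
        LinearMap.id_apply]
    -- The differential of `A` anticommutes with the parity involution, so the mixed terms cancel
    -- and `star φ` of the equation on `V` remains.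
    have e2 : (φ ∘ₗ 𝒜.tw 1) ∘ₗ 𝒜.d = -((φ ∘ₗ 𝒜.d) ∘ₗ 𝒜.tw 1) := LinearMap.ext fun b => by
      simp [𝒜.d_tw]
    simp only [map_add, map_zero] at h
    simp only [bracket, mul_one, sgn_one, neg_neg, one_smul, LinearMap.add_apply,
      LinearMap.comp_apply, LinearMap.smul_apply, tensorM_star, diff_star, map_add, e1, e2,
      map_neg, LinearMap.neg_apply]
    rw [← h]
    module

theorem tensorLInfty_isTensorProduct : IsTensorProduct 𝒜 L (tensorLInfty 𝒜 L) := by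
  intro l s hs
  have h1 : koszul 1 s = (s.map Prod.fst).sum + koszul 0 s := by
    have h := koszul_eq 1 0 s
    rwa [add_zero, one_mul] at h
  set B := stdFrame 𝒜.toDGSpace
  set C := stdFrame 𝒱.shift
  have key : ∀ i, (B.tensor C).x i (taylor (tensorLInfty 𝒜 L).m (l.map fun x => x.1 ⊗ₜ[k] x.2)) =
      (B.tensor C).x i (sgn k (koszul 1 s) •
        ((l.map Prod.fst).prod ⊗ₜ[k] taylor L.m (l.map Prod.snd))) := by
    intro i
    rw [lin_apply_taylor, B.lin_tensor]
    change (tensorM 𝒜 L _).1 _ = _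
    have e : (B.tensor C).x i ((l.map Prod.fst).prod ⊗ₜ[k] taylor L.m (l.map Prod.snd)) =
      B.x i.1 (l.map Prod.fst).prod * C.x i.2 (taylor L.m (l.map Prod.snd)) := rfl
    rw [tensorM_star, star_apply 𝒜 _ _ hs, LinearMap.comp_apply,
      𝒜.tw_of_mem 1 (𝒜.list_prod_mem hs), map_smul, map_smul, e, h1, sgn_add, one_mul,
      ← lin_apply_taylor]
    simp only [smul_eq_mul]
    ring
  rw [← (B.tensor C).sum_eq (taylor _ _)]
  simp only [key]
  exact (B.tensor C).sum_eq _

/-- Taylor coefficients on homogeneous pure tensors determine the values on coordinates, and these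
determine the derivation. -/
theorem isTensorProduct_unique {M M' : LInfty (𝒜.toDGSpace.tensor 𝒱)}
    (hM : IsTensorProduct 𝒜 L M) (hM' : IsTensorProduct 𝒜 L M') : M' = M := by
  refine LInfty.ext ((stdFrame _).ext_of_map_lin M'.isDer M.isDer fun i => ?_)
  refine tensorForm_ext 𝒜 𝒱 fun l s hs => ?_
  rw [← lin_apply_taylor, ← lin_apply_taylor, hM l s hs, hM' l s hs]

theorem divergence_tensorLInfty :
    divergence 1 (tensorLInfty 𝒜 L).m = star 𝒜 𝒱 𝒜.mulTrace (divergence 1 L.m) :=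
  HomFrame.divergence_tensorField _ _ L.isDer

end Tensor

/-! ### Restriction to `e ⊗ V`, for an idempotent `e` -/

section Restriction

variable {k A V : Type*} [Field k] [CharZero k] [Ring A] [Algebra k A] [AddCommGroup V]
  [Module k V] {𝒜 : CDGA k A} {e : A} (he : e ∈ 𝒜.part 0)

/-- The restriction of functions on `Π(A ⊗ V)` to `e ⊗ V`. -/
def restr (𝒱 : DGSpace k V) : Form (tensorShift 𝒜 𝒱) →ₗ[k] Form 𝒱.shift :=
  pullback (TensorProduct.mk k A V e) (mk_mem_tensorShift 𝒜 he)

variable {𝒱 : DGSpace k V}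

theorem deriv_restr (v : V) (f : Form (tensorShift 𝒜 𝒱)) :
    deriv _ v (restr he 𝒱 f) = restr he 𝒱 (deriv _ (e ⊗ₜ v) f) := rfl

theorem restr_mul (f g : Form (tensorShift 𝒜 𝒱)) :
    restr he 𝒱 (mul f g) = mul (restr he 𝒱 f) (restr he 𝒱 g) := pullback_mul f g

theorem restr_star_apply (φ : Module.Dual k A) (g : Form 𝒱.shift) {l : List V}
    (hl : ∀ v ∈ l, ∃ i, v ∈ 𝒱.shift.part i) :
    (restr he 𝒱 (star 𝒜 𝒱 φ g)).1 l = φ (e ^ l.length) * g.1 l := by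
  have hpow : ∀ n : ℕ, e ^ n ∈ 𝒜.part 0 := by
    intro n
    induction n with
    | zero => rw [pow_zero]; exact 𝒜.one_mem
    | succ n ih => rw [pow_succ]; simpa using 𝒜.mul_mem _ _ _ ih _ he
  induction l generalizing φ g with
  | nil => simp [restr, pullback_apply, star_nil]
  | cons v l ih =>
    obtain ⟨j, hj⟩ := hl v (by simp)
    rw [form_cons, deriv_restr, deriv_star 𝒜 e hj,
      ih _ _ fun u hu => hl u (by simp [hu]), 𝒜.act_apply, 𝒜.tw_of_mem j (hpow _), mul_zero,
      sgn_zero, one_smul, ← pow_succ', List.length_cons, form_cons]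

/-- `eⁿ = e` needs `n ≥ 1`: in arity zero the empty product is `1`, so `g` must have no constant
term. -/
theorem restr_star (hee : e * e = e) (φ : Module.Dual k A) {g : Form 𝒱.shift} (hg : AtLeast 1 g) :
    restr he 𝒱 (star 𝒜 𝒱 φ g) = φ e • g := by
  refine form_ext_homog fun l hl => ?_
  rw [restr_star_apply he φ g hl, Submodule.coe_smul, Pi.smul_apply, smul_eq_mul]
  rcases l with _ | ⟨v, l⟩
  · rw [hg [] (by simp), mul_zero, mul_zero]
  · rw [List.length_cons, IsIdempotentElem.pow_succ_eq l.length hee]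

theorem restr_diff (hee : e * e = e) (f : Form (tensorShift 𝒜 𝒱)) :
    restr he 𝒱 (diff _ f) = diff _ (restr he 𝒱 f) := by
  refine pullback_diff (fun v => ?_) f
  rw [TensorProduct.mk_apply, TensorProduct.mk_apply, tensorShift_d 𝒜 e he,
    𝒜.d_idempotent he hee, TensorProduct.zero_tmul, zero_add, sgn_zero, one_smul]

/-- On `e ⊗ V` the coefficient with index `(j, i)` becomes `x_j(e) m(y_i)`, and `∑_j x_j(e) ∂_{e_j ⊗
c_i} = ∂_{e ⊗ c_i}`. -/
theorem restr_tensorM [FiniteDimensional k A] [FiniteDimensional k V] (L : LInfty 𝒱)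
    (hee : e * e = e) (f : Form (tensorShift 𝒜 𝒱)) :
    restr he 𝒱 (tensorM 𝒜 L f) = L.m (restr he 𝒱 f) := by
  rw [tensorM, HomFrame.tensorField, HomFrame.field_apply, map_sum,
    L.isDer.apply_eq_sum (stdFrame 𝒱.shift), Fintype.sum_prod_type, Finset.sum_comm]
  refine Finset.sum_congr rfl fun i _ => ?_
  set B := stdFrame 𝒜.toDGSpace
  set C := stdFrame 𝒱.shift
  have h : deriv 𝒱.shift (C.e i) (restr he 𝒱 f) =
      ∑ j, B.x j e • restr he 𝒱 (deriv (tensorShift 𝒜 𝒱) (B.e j ⊗ₜ C.e i) f) := by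
    have h' : e ⊗ₜ[k] C.e i = ∑ j, B.x j e • (B.e j ⊗ₜ[k] C.e i) := by
      conv_lhs => rw [← B.sum_eq e, TensorProduct.sum_tmul]
      simp only [TensorProduct.smul_tmul']
    rw [deriv_restr, h', deriv_sum, map_sum]
    simp only [deriv_smul, map_smul]
  rw [h, mul_sum_right]
  refine Finset.sum_congr rfl fun j _ => ?_
  rw [restr_mul, restr_star he hee _ ((L.atLeast _).mono one_le_two),
    LinearMap.comp_apply, 𝒜.tw_of_mem 1 he, mul_zero, sgn_zero, one_smul, mul_smul_left,
    mul_smul_right]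
  rfl

end Restriction

/-! ### The two unimodularity criteria -/

section Unimodular

variable {k A V : Type*} [Field k] [CharZero k] [Ring A] [Algebra k A] [FiniteDimensional k A]
  [AddCommGroup V] [Module k V] [FiniteDimensional k V]
  (𝒜 : CDGA k A) {𝒱 : DGSpace k V} (L : LInfty 𝒱)

theorem tensorLInfty_strictlyUnimodular_iff :
    (tensorLInfty 𝒜 L).StrictlyUnimodular ↔ L.StrictlyUnimodular ∨ 𝒜.Unimodular := by
  rw [LInfty.strictlyUnimodular_iff, LInfty.strictlyUnimodular_iff, 𝒜.unimodular_iff,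
    divergence_tensorLInfty]
  refine ⟨fun h => or_iff_not_imp_left.mpr fun hL => ?_, ?_⟩
  · obtain ⟨l, hl, hne⟩ : ∃ l : List V, (∀ v ∈ l, ∃ i, v ∈ 𝒱.shift.part i) ∧
        (divergence 1 L.m).1 l ≠ 0 := by
      by_contra hcon
      push Not at hcon
      exact hL (form_ext_homog hcon)
    -- Without a constant term there is at least one argument `v` to pair with an arbitrary `a`.
    -- Pairing the others with `1` evaluates `star τ (∇m)` to `τ(a)` times a nonzero value.
    rcases l with _ | ⟨v, l⟩
    · exact absurd (L.divergence_atLeast [] (by simp)) hne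
    obtain ⟨j, hj⟩ := hl v (by simp)
    refine LinearMap.ext fun a => ?_
    have hl' : ∀ u ∈ l, ∃ i, u ∈ 𝒱.shift.part i := fun u hu => hl u (by simp [hu])
    have h1 := congrArg (fun f => (restr 𝒜.one_mem 𝒱 (deriv _ (a ⊗ₜ v) f)).1 l) h
    simp only [deriv_star 𝒜 a hj, map_zero,
      restr_star_apply 𝒜.one_mem _ _ hl', one_pow, 𝒜.act_apply,
      𝒜.tw_unit, mul_one] at h1
    exact (mul_eq_zero.mp h1).resolve_right hne
  · rintro (h | h)
    · rw [h, map_zero]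
    · rw [h, map_zero, LinearMap.zero_apply]

theorem tensorLInfty_admitsUnimodularLift (h : L.AdmitsUnimodularLift ∨ 𝒜.Unimodular) :
    (tensorLInfty 𝒜 L).AdmitsUnimodularLift := by
  rcases h with ⟨f, hf, h⟩ | h
  -- As `τ` is unchanged by twisting and vanishes on exact elements, `star τ` commutes with the
  -- differentials and the `L_∞` structures.
  · refine ⟨star 𝒜 𝒱 𝒜.mulTrace f, ?_, ?_⟩
    · rw [hasParity_iff, formTw_star, 𝒜.mulTrace_comp_tw, hf.formTw, mul_zero, sgn_zero,
        one_smul, one_smul]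
    · change _ + _ + tensorM 𝒜 L _ = 0
      rw [divergence_tensorLInfty, tensorM_star, diff_star, 𝒜.mulTrace_comp_tw, 𝒜.mulTrace_d,
        map_zero, LinearMap.zero_apply, add_zero, ← map_smul, ← map_add, ← map_add, h, map_zero]
  · exact ⟨0, ((tensorLInfty_strictlyUnimodular_iff 𝒜 L).mpr (Or.inr h))⟩

/-- Restriction to `e ⊗ V` commutes with the differentials and the `L_∞` structures but multiplies
the divergence by `τ(e)`, which the scalar in the witness undoes. -/
theorem admitsUnimodularLift_of_idempotent {𝒜} {e : A} (he : e ∈ 𝒜.part 0) (hee : e * e = e)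
    (htr : 𝒜.mulTrace e ≠ 0) (h : (tensorLInfty 𝒜 L).AdmitsUnimodularLift) :
    L.AdmitsUnimodularLift := by
  obtain ⟨F, hF, h⟩ := h
  refine ⟨(𝒜.mulTrace e)⁻¹ • restr he 𝒱 F, HasParity.smul _ hF.pullback, ?_⟩
  have h1 := congrArg (fun f => (𝒜.mulTrace e)⁻¹ • restr he 𝒱 f) h
  change (𝒜.mulTrace e)⁻¹ • restr he 𝒱 (_ + _ + tensorM 𝒜 L F) = _ at h1
  rw [divergence_tensorLInfty, map_add, map_add, map_smul, restr_diff he hee,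
    restr_tensorM he L hee, restr_star he hee _ L.divergence_atLeast, map_zero, smul_zero] at h1
  rw [← h1]
  simp only [map_smul, smul_add, smul_smul]
  rw [mul_left_comm, inv_mul_cancel₀ htr, mul_one]

end Unimodular

/-! ### Traces and idempotents -/

section Idempotents

open Polynomial

/-- `X - M` divides `p(X) - p(M)`, which is the scalar matrix `p(X)`; take determinants. The
divisibility is first obtained in `R[X][X]`, whose outer variable `φ` sends to `M`. -/
theorem charpoly_dvd_pow_card {R n : Type*} [CommRing R] [Fintype n] [DecidableEq n]
    (M : Matrix n n R) {p : R[X]} (hp : aeval M p = 0) : M.charpoly ∣ p ^ Fintype.card n := by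
  let φ : R[X][X] →ₐ[R[X]] Matrix n n R[X] := aeval ((CAlgHom (R := R) (A := R)).mapMatrix M)
  obtain ⟨g, hg⟩ := sub_dvd_eval_sub (C X : R[X][X]) X (p.map (algebraMap R R[X][X]))
  have h1 := congrArg (φ.restrictScalars R) hg
  have h2 : aeval (C X : R[X][X]) p = algebraMap R[X] R[X][X] p := by
    have h := aeval_algebraMap_apply R[X][X] (X : R[X]) p
    rwa [aeval_X_left_apply] at h
  have h3 : φ (algebraMap R[X] R[X][X] p) = p • (1 : Matrix n n R[X]) := by
    rw [AlgHom.commutes, Algebra.algebraMap_eq_smul_one]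
  have h4 : φ.restrictScalars R (aeval X p) = 0 := by
    rw [← aeval_algHom_apply, AlgHom.restrictScalars_apply, aeval_X, aeval_algHom_apply, hp,
      map_zero]
  have h5 : φ (C X - X) = M.charmatrix := by
    rw [map_sub, aeval_X, aeval_C]
    rfl
  rw [eval_map_algebraMap, eval_map_algebraMap, map_sub, h4, sub_zero, h2, map_mul,
    AlgHom.restrictScalars_apply, AlgHom.restrictScalars_apply, h3, h5] at h1
  have h6 := congrArg Matrix.det h1
  rw [Matrix.det_smul, Matrix.det_one, mul_one, Matrix.det_mul] at h6
  exact ⟨_, h6⟩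

/-- The characteristic polynomial is a power of `p`; compare degrees and subleading coefficients. -/
theorem natDegree_mul_trace {K N : Type*} [Field K] [AddCommGroup N] [Module K N]
    [FiniteDimensional K N] (T : N →ₗ[K] N) {p : K[X]} (hp : Irreducible p) (hm : p.Monic) {n : ℕ}
    (h : aeval T (p ^ n) = 0) :
    (p.natDegree : K) * LinearMap.trace K N T = -p.nextCoeff * Module.finrank K N := by
  set b := Module.finBasis K N
  have hM : aeval (LinearMap.toMatrixAlgEquiv b T) (p ^ n) = 0 := by
    rw [aeval_algHom_apply, h, map_zero]
  have hch : (LinearMap.toMatrixAlgEquiv b T).charpoly = T.charpoly := LinearMap.charpoly_toMatrix T b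
  have hdvd := charpoly_dvd_pow_card _ hM
  rw [hch, ← pow_mul] at hdvd
  obtain ⟨m, -, hmm⟩ := (dvd_prime_pow hp.prime _).mp hdvd
  have e := eq_of_monic_of_associated T.charpoly_monic (hm.pow m) hmm
  have hdeg : (m * p.natDegree : ℕ) = Module.finrank K N := by
    rw [← natDegree_pow, ← e, LinearMap.charpoly_natDegree]
  have htr : LinearMap.trace K N T = -T.charpoly.nextCoeff := by
    rw [LinearMap.trace_eq_matrix_trace K b, Matrix.trace_eq_neg_charpoly_nextCoeff,
      LinearMap.charpoly_toMatrix]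
  rw [htr, e, hm.nextCoeff_pow, ← hdeg, nsmul_eq_mul]
  push_cast
  ring

theorem eq_zero_of_idempotent {K B : Type*} [Field K] [CharZero K] [CommRing B] [Algebra K B]
    [FiniteDimensional K B] (τ : B →ₗ[K] K) (h : ∀ e, e * e = e → τ e = 0)
    (hp : ∀ (p : K[X]) (n : ℕ) (a e : B), Irreducible p → p.Monic → e * e = e →
      aeval a (p ^ n) * e = 0 → (p.natDegree : K) * τ (a * e) = -p.nextCoeff * τ e) (a : B) :
    τ a = 0 := by
  -- Stated for all `μ` and `e`, so that coprime factors of the minimal polynomial can be treated on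
  -- smaller idempotents.
  suffices key : ∀ μ : K[X], μ ≠ 0 → ∀ e : B, e * e = e → aeval a μ * e = 0 → τ (a * e) = 0 by
    have h1 := key (minpoly K a) (minpoly.ne_zero (Algebra.IsIntegral.isIntegral a)) 1 (one_mul 1)
      (by rw [minpoly.aeval, zero_mul])
    rwa [mul_one] at h1
  intro μ
  induction μ using UniqueFactorizationMonoid.induction_on_coprime with
  | h0 => intro h0; exact absurd rfl h0
  | @h1 u hu =>
    intro _ e _ he0
    have h0 : e = 0 := ((hu.map (aeval a)).mul_right_eq_zero).mp he0
    rw [h0, mul_zero, map_zero]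
  | @hpr p n hprime =>
    intro _ e he he0
    have hl : p.leadingCoeff ≠ 0 := leadingCoeff_ne_zero.mpr hprime.ne_zero
    have hu : IsUnit (C p.leadingCoeff⁻¹) := isUnit_C.mpr (inv_ne_zero hl).isUnit
    have hirr : Irreducible (p * C p.leadingCoeff⁻¹) :=
      (irreducible_mul_isUnit hu).mpr hprime.irreducible
    have h1 := hp _ n a e hirr (monic_mul_leadingCoeff_inv hprime.ne_zero) he (by
      rw [mul_pow, map_mul, mul_right_comm, he0, zero_mul])
    rw [h e he, mul_zero] at h1
    refine (mul_eq_zero.mp h1).resolve_left ?_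
    exact_mod_cast hirr.natDegree_pos.ne'
  | @hcp x y hxy hx hy =>
    intro hne e he he0
    obtain ⟨u, v, huv⟩ := hxy.isCoprime
    have huv' := congrArg (aeval a) huv
    simp only [map_add, map_mul, map_one] at huv' he0
    set U := aeval a u
    set V := aeval a v
    set X' := aeval a x
    set Y := aeval a y
    -- Bézout splits `e` into the orthogonal idempotents `U X' e` and `V Y e`, annihilated by `Y`
    -- and `X'` respectively.
    have e1 : τ (a * (U * X' * e)) = 0 := by
      refine hy (right_ne_zero_of_mul hne) _ ?_ ?_
      · linear_combination (U * X' * e) * huv' + (U * X') ^ 2 * he - U * V * he0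
      · linear_combination U * he0
    have e2 : τ (a * (V * Y * e)) = 0 := by
      refine hx (left_ne_zero_of_mul hne) _ ?_ ?_
      · linear_combination (V * Y * e) * huv' + (V * Y) ^ 2 * he - U * V * he0
      · linear_combination V * he0
    have e3 : a * e = a * (U * X' * e) + a * (V * Y * e) := by
      linear_combination (-a * e) * huv'
    rw [e3, map_add, e1, e2, add_zero]

end Idempotents

/-! ### Even idempotents of nonzero supertrace -/

section Algebra

open Polynomial

variable {k A : Type*} [Field k] [Ring A] [Algebra k A] (𝒜 : CDGA k A)

/-- The even part of a cdga. -/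
def CDGA.even : Subalgebra k A where
  carrier := 𝒜.part 0
  add_mem' := (𝒜.part 0).add_mem
  mul_mem' {a b} ha hb := by simpa using 𝒜.mul_mem 0 0 a ha b hb
  algebraMap_mem' c := by
    rw [Algebra.algebraMap_eq_smul_one]
    exact Submodule.smul_mem _ _ 𝒜.one_mem

theorem CDGA.mul_comm_even {a : A} (ha : a ∈ 𝒜.part 0) (b : A) : a * b = b * a := by
  rw [𝒜.mul_eq_tw_mul ha, 𝒜.tw_zero, LinearMap.id_apply]

instance CDGA.evenCommRing : CommRing 𝒜.even :=
  { (inferInstance : Ring 𝒜.even) with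
    mul_comm := fun a b => Subtype.ext (𝒜.mul_comm_even a.2 b) }

theorem CDGA.mulTrace_eq_sub (a : A) :
    𝒜.mulTrace a = LinearMap.trace k A (LinearMap.mulLeft k a ∘ₗ 𝒜.proj 0) -
      LinearMap.trace k A (LinearMap.mulLeft k a ∘ₗ 𝒜.proj 1) := by
  rw [𝒜.mulTrace_apply, DGSpace.supertrace, DGSpace.invol, LinearMap.comp_sub, map_sub]

variable [FiniteDimensional k A]

/-- If `a` is annihilated on `e A` by a power of an irreducible polynomial, then its trace on the
part of `e A` of parity `i` is proportional to the dimension of that part. -/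
theorem CDGA.natDegree_mul_trace (i : ZMod 2) {p : k[X]} (hp : Irreducible p) (hm : p.Monic)
    {n : ℕ} {a e : A} (ha : a ∈ 𝒜.part 0) (he : e ∈ 𝒜.part 0) (hee : e * e = e)
    (h : aeval a (p ^ n) * e = 0) :
    (p.natDegree : k) * LinearMap.trace k A (LinearMap.mulLeft k (a * e) ∘ₗ 𝒜.proj i) =
      -p.nextCoeff * LinearMap.trace k A (LinearMap.mulLeft k e ∘ₗ 𝒜.proj i) := by
  -- `N` is the part of `eA` of parity `i`. The operator on the right is a projection onto `N`, with
  -- trace `dim N`; the one on the left maps into `N`, so its trace is that of multiplication by `a`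
  -- on `N`.
  let N : Submodule k A := 𝒜.part i ⊓ LinearMap.eqLocus (LinearMap.mulLeft k e) LinearMap.id
  have hN : ∀ x, x ∈ N ↔ x ∈ 𝒜.part i ∧ e * x = x := fun x => Iff.rfl
  have hP : LinearMap.IsProj N (LinearMap.mulLeft k e ∘ₗ 𝒜.proj i) := by
    refine ⟨fun x => (hN _).mpr ⟨?_, ?_⟩, fun x hx => ?_⟩
    · simpa using 𝒜.mul_mem _ _ e he _ (𝒜.proj_mem i x)
    · simp only [LinearMap.comp_apply, LinearMap.mulLeft_apply, ← _root_.mul_assoc, hee]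
    · simp only [LinearMap.comp_apply, LinearMap.mulLeft_apply]
      rw [𝒜.proj_self ((hN x).mp hx).1, ((hN x).mp hx).2]
  have hS : ∀ x, (LinearMap.mulLeft k (a * e) ∘ₗ 𝒜.proj i) x ∈ N := by
    refine fun x => (hN _).mpr ⟨?_, ?_⟩
    · have hae : a * e ∈ 𝒜.part 0 := by simpa using 𝒜.mul_mem _ _ a ha _ he
      have h1 := 𝒜.mul_mem _ _ _ hae _ (𝒜.proj_mem i x)
      rwa [zero_add] at h1
    · simp only [LinearMap.comp_apply, LinearMap.mulLeft_apply]
      rw [← _root_.mul_assoc, ← _root_.mul_assoc, ← 𝒜.mul_comm_even ha e, _root_.mul_assoc a e e, hee]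
  set T := (LinearMap.mulLeft k (a * e) ∘ₗ 𝒜.proj i).restrict fun x (_ : x ∈ N) => hS x
  have hT : ∀ x : N, (T x : A) = a * x := fun x => by
    change a * e * 𝒜.proj i x = _
    rw [𝒜.proj_self ((hN x).mp x.2).1, _root_.mul_assoc, ((hN x).mp x.2).2]
  have hTq : ∀ (q : k[X]) (x : N), (aeval T q x : A) = aeval a q * x := by
    intro q x
    induction q using Polynomial.induction_on' with
    | add q r hq hr =>
      rw [map_add, map_add, LinearMap.add_apply, Submodule.coe_add, hq, hr, add_mul]
    | monomial m c =>
      have hpow : ∀ m : ℕ, ((T ^ m) x : A) = a ^ m * x := by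
        intro m
        induction m with
        | zero => simp
        | succ m ih => rw [pow_succ', Module.End.mul_apply, hT, ih, pow_succ', _root_.mul_assoc]
      rw [aeval_monomial, aeval_monomial, Module.End.mul_apply, Module.algebraMap_end_apply,
        Submodule.coe_smul, hpow, Algebra.algebraMap_eq_smul_one, smul_mul_assoc, one_mul,
        smul_mul_assoc]
  have hT0 : aeval T (p ^ n) = 0 := by
    refine LinearMap.ext fun x => Subtype.ext ?_
    rw [hTq, ← ((hN x).mp x.2).2, ← _root_.mul_assoc, h, zero_mul]
    rfl
  have htr : LinearMap.trace k N T = _ :=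
    LinearMap.trace_restrict_eq_of_forall_mem N (LinearMap.mulLeft k (a * e) ∘ₗ 𝒜.proj i) hS
  rw [← htr, hP.trace]
  exact SuperLInfty.natDegree_mul_trace T hp hm hT0

/-- A cdga that is not unimodular has an even idempotent of nonzero trace. -/
theorem CDGA.exists_idempotent [CharZero k] (h : ¬𝒜.Unimodular) :
    ∃ e ∈ 𝒜.part 0, e * e = e ∧ 𝒜.mulTrace e ≠ 0 := by
  by_contra! hcon
  refine h (𝒜.unimodular_iff.mpr (𝒜.hom_ext fun i a ha => ?_))
  rcases zmod_two_cases i with rfl | rfl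
  swap
  · exact 𝒜.mulTrace_odd ha
  refine eq_zero_of_idempotent (B := 𝒜.even) (𝒜.mulTrace ∘ₗ 𝒜.even.val.toLinearMap)
    (fun e he => hcon e e.2 (congrArg Subtype.val he)) (fun p n b e hp hm he hpe => ?_) ⟨a, ha⟩
  have hpe' : aeval (b : A) (p ^ n) * (e : A) = 0 := by
    have h1 := congrArg 𝒜.even.val hpe
    rwa [map_mul, ← aeval_algHom_apply, map_zero] at h1
  have h0 := 𝒜.natDegree_mul_trace 0 hp hm b.2 e.2 (congrArg Subtype.val he) hpe'
  have h1 := 𝒜.natDegree_mul_trace 1 hp hm b.2 e.2 (congrArg Subtype.val he) hpe'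
  change (p.natDegree : k) * 𝒜.mulTrace ((b : A) * (e : A)) = -p.nextCoeff * 𝒜.mulTrace (e : A)
  -- The coefficients depend on `p` only, not on the parity, so the relation for traces passes to
  -- the supertrace.
  rw [𝒜.mulTrace_eq_sub, 𝒜.mulTrace_eq_sub, mul_sub, mul_sub, h0, h1]

end Algebra

end SuperLInfty

end

theorem theorem7p7 {k : Type*} [Field k] [CharZero k]
    {A : Type*} [Ring A] [Algebra k A] [FiniteDimensional k A] (𝒜 : SuperLInfty.CDGA k A)
    {V : Type*} [AddCommGroup V] [Module k V] [FiniteDimensional k V]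
    (𝒱 : SuperLInfty.DGSpace k V) (L : SuperLInfty.LInfty 𝒱) :
    ∃ M : SuperLInfty.LInfty (𝒜.toDGSpace.tensor 𝒱),
      SuperLInfty.IsTensorProduct 𝒜 L M ∧
      (∀ M' : SuperLInfty.LInfty (𝒜.toDGSpace.tensor 𝒱),
        SuperLInfty.IsTensorProduct 𝒜 L M' → M' = M) ∧
      (M.StrictlyUnimodular ↔ L.StrictlyUnimodular ∨ 𝒜.Unimodular) ∧
      (M.AdmitsUnimodularLift ↔ L.AdmitsUnimodularLift ∨ 𝒜.Unimodular) := by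
  refine ⟨SuperLInfty.tensorLInfty 𝒜 L, SuperLInfty.tensorLInfty_isTensorProduct 𝒜 L,
    fun M' hM' => SuperLInfty.isTensorProduct_unique 𝒜 L
      (SuperLInfty.tensorLInfty_isTensorProduct 𝒜 L) hM',
    SuperLInfty.tensorLInfty_strictlyUnimodular_iff 𝒜 L,
    fun h => or_iff_not_imp_right.mpr fun hA => ?_,
    SuperLInfty.tensorLInfty_admitsUnimodularLift 𝒜 L⟩
  obtain ⟨e, he, hee, htr⟩ := 𝒜.exists_idempotent hA
  exact SuperLInfty.admitsUnimodularLift_of_idempotent L he hee htr h
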